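/- Let $S^1=\mathbb R/2\pi\mathbb Z$ and $\mathbb{RP}^1=\mathbb R\cup\{\infty\}$. A projective structure $\alpha$ on $S^1$ is given by a developing map, i.e. a smooth immersion $\varphi:\mathbb R\to\mathbb{RP}^1$ with $\varphi(x+2\pi)=T\varphi(x)$ for some $T\in PGL(2,\mathbb R)$, modulo $\varphi\mapsto A\circ\varphi$, $A\in PGL(2,\mathbb R)$. For $T\in PGL(2,\mathbb R)$ let $\mathcal P_T(S^1)$ be the space of the structures whose monodromy is in the conjugacy class of $T$. The Schwarzian derivative $S(\varphi)=\frac{\varphi'''}{\varphi'}-\frac32\big(\frac{\varphi''}{\varphi'}\big)^2$ (computed in any affine coordinate of $\mathbb{RP}^1$) depends only on $\alpha$ and is an affine coordinate on the space of projective structures; a vector field $\xi\in\mathrm{Vect}(S^1)$ (smooth, $2\pi$-periodic) acts by $L_\xi\alpha=\xi S'+2\xi'S+\xi'''$, where $S=S(\varphi)$, and $T_\alpha\mathcal P_T(S^1)=\{L_\xi\alpha:\xi\in\mathrm{Vect}(S^1)\}\cong\mathrm{Vect}(S^1)/\mathrm{aut}(\alpha)$, with $\mathrm{aut}(\alpha)=\{\xi:L_\xi\alpha=0\}$.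 For every $\alpha\in\mathcal P_T(S^1)$ there is a point $x_0$ such that every tangent vector at $\alpha$ is $L_\xi\alpha$ for some $\xi$ with $\xi(x_0)=0$. For $\delta_i\alpha=L_{\xi_i}\alpha$ with $\xi_1(x_0)=\xi_2(x_0)=0$, a developing map $\varphi$ of $\alpha$, an affine parameter $t$ of $\mathbb{RP}^1$ (the standard one composed with a homography) and $\theta=\varphi^*(dt)$, put $$\omega(\delta_1\alpha,\delta_2\alpha)=\int_{x_0}^{x_0+2\pi}\frac{L_{\xi_1}\theta}{\theta}\,d\,\frac{L_{\xi_2}\theta}{\theta}.$$ The integral is a convergent ordinary integral if $t\circ\varphi$ is finite on $(x_0,x_0+2\pi)$; in general it is the Hadamard finite part at the points where $t\circ\varphi=\infty$ (the constant term as $\varepsilon\to0^+$ of the integral outside the $\varepsilon$-neighbourhoods of these points, the remaining divergent terms being polynomial in $1/\varepsilon$ without constant term). Then: 1. $\omega$ is well defined: the value exists and depends only on $\alpha,\delta_1\alpha,\delta_2\alpha$, and not on $x_0$, $\xi_1$, $\xi_2$, $\varphi$, $t$; $\omega$ is the unique family of functions on pairs of tangent vectors of $\mathcal P_T(S^1)$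 given by this integral, and it is bilinear and alternating. 2. $\omega$ is smooth and closed: its pull-back by each smooth three-parameter family $F:\mathbb R^3\to\mathcal P_T(S^1)$, with $\partial_iF=L_{\xi_i}F$ for vector fields $\xi_i$ that depend smoothly on the parameters, is a smooth closed 2-form. 3. $\omega$ is nondegenerate on every $T_\alpha\mathcal P_T(S^1)$. 4. For all $\xi_1,\xi_2\in\mathrm{Vect}(S^1)$, with $[\xi_1,\xi_2]=\xi_1\xi_2'-\xi_1'\xi_2$, $$\omega(L_{\xi_1}\alpha,L_{\xi_2}\alpha)=-\int_0^{2\pi}S(\varphi)\,[\xi_1,\xi_2]\,dx+\int_0^{2\pi}\xi_1'\,\xi_2''\,dx.$$ -/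

import Mathlib

open scoped ContDiff Topology MatrixGroups
open MeasureTheory Filter

noncomputable section

namespace CircleProj

/-! ### The projective line, immersed curves and the Schwarzian derivative -/

/-- The real projective line `ℝ ∪ {∞}`, with the action of `GL(2, ℝ)` by homographies
(scalars act trivially, so this is the action of `PGL(2, ℝ)`). -/
abbrev RP1 : Type := OnePoint ℝ

/-- The affine coordinate on the projective line. Its value at the point at infinity is
a convention. -/
def coord (p : RP1) : ℝ := p.elim 0 id

/-- A smooth immersion of the line in the projective line: near each point, in a suitable affine
chart, it is a smooth real function with nonzero derivative. -/
def IsImmersion (φ : ℝ → RP1) : Prop :=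
  ∀ x : ℝ, ∃ (g : GL (Fin 2) ℝ) (f : ℝ → ℝ), ContDiffAt ℝ ∞ f x ∧ deriv f x ≠ 0 ∧
    ∀ᶠ y in 𝓝 x, g • φ y = ((f y : ℝ) : RP1)

/-- The classical Schwarzian derivative of a real function. -/
def schwarzReal (f : ℝ → ℝ) (x : ℝ) : ℝ :=
  deriv (deriv (deriv f)) x / deriv f x - 3 / 2 * (deriv (deriv f) x / deriv f x) ^ 2

/-- The homography `t ↦ 1 / t`. -/
def invGL : GL (Fin 2) ℝ :=
  Matrix.GeneralLinearGroup.mkOfDetNeZero !![0, 1; 1, 0] (by simp [Matrix.det_fin_two])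

open Classical in
/-- The Schwarzian derivative of a curve in the projective line, computed in the affine
coordinate `t` where the curve is finite and in the coordinate `1 / t` where it is infinite. -/
def schwarz (φ : ℝ → RP1) (x : ℝ) : ℝ :=
  if φ x = OnePoint.infty then schwarzReal (fun y => coord (invGL • φ y)) x
  else schwarzReal (fun y => coord (φ y)) x

theorem contDiffAt_deriv {f : ℝ → ℝ} {x : ℝ} {n : ℕ} (h : ContDiffAt ℝ (n + 1 : ℕ) f x) :
    ContDiffAt ℝ (n : ℕ) (deriv f) x := by
  have h1 : ContDiffAt ℝ (n : ℕ) (fderiv ℝ f) x := h.fderiv_right (by norm_cast)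
  have h2 : ContDiffAt ℝ (n : ℕ) (fun y => fderiv ℝ f y 1) x := h1.clm_apply contDiffAt_const
  exact h2

theorem schwarzReal_congr {f h : ℝ → ℝ} {x : ℝ} (e : f =ᶠ[𝓝 x] h) :
    schwarzReal f x = schwarzReal h x := by
  unfold schwarzReal
  rw [e.deriv_eq, e.deriv.deriv_eq, e.deriv.deriv.deriv_eq]

theorem schwarzReal_mobius {f : ℝ → ℝ} {x : ℝ} (hf : ContDiffAt ℝ ∞ f x) (hd : deriv f x ≠ 0)
    (a b c d : ℝ) (hdet : a * d - b * c ≠ 0) (hne : c * f x + d ≠ 0) :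
    schwarzReal (fun y => (a * f y + b) / (c * f y + d)) x = schwarzReal f x := by
  have h4 : ContDiffAt ℝ (4 : ℕ) f x := contDiffAt_infty.1 hf 4
  have e4 : ∀ᶠ y in 𝓝 x, ContDiffAt ℝ (4 : ℕ) f y := h4.eventually (by simp)
  have hcont : ContinuousAt (fun y => c * f y + d) x := by
    have := hf.continuousAt
    fun_prop
  have ene : ∀ᶠ y in 𝓝 x, c * f y + d ≠ 0 := hcont.eventually_ne hne
  have D0 : ∀ y, ContDiffAt ℝ (4 : ℕ) f y → HasDerivAt f (deriv f y) y := fun y h =>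
    (h.differentiableAt (by simp)).hasDerivAt
  have D1 : ∀ y, ContDiffAt ℝ (4 : ℕ) f y → HasDerivAt (deriv f) (deriv (deriv f) y) y := by
    intro y h
    have h' : ContDiffAt ℝ (3 : ℕ) (deriv f) y := contDiffAt_deriv h
    exact (h'.differentiableAt (by simp)).hasDerivAt
  have D2 : ∀ y, ContDiffAt ℝ (4 : ℕ) f y →
      HasDerivAt (deriv (deriv f)) (deriv (deriv (deriv f)) y) y := by
    intro y h
    have h' : ContDiffAt ℝ (2 : ℕ) (deriv (deriv f)) y := contDiffAt_deriv (contDiffAt_deriv h)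
    exact (h'.differentiableAt (by simp)).hasDerivAt
  have E1 : deriv (fun y => (a * f y + b) / (c * f y + d)) =ᶠ[𝓝 x]
      fun y => (a * d - b * c) * deriv f y / (c * f y + d) ^ 2 := by
    filter_upwards [e4, ene] with y h hn
    have := (((D0 y h).const_mul a).add_const b).div (((D0 y h).const_mul c).add_const d) hn
    refine (this.congr_deriv ?_).deriv
    field_simp
    ring
  have E2 : deriv (deriv (fun y => (a * f y + b) / (c * f y + d))) =ᶠ[𝓝 x]
      fun y => (a * d - b * c) * (deriv (deriv f) y * (c * f y + d) - 2 * c * deriv f y ^ 2) /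
        (c * f y + d) ^ 3 := by
    refine E1.deriv.trans ?_
    filter_upwards [e4, ene] with y h hn
    have := ((D1 y h).const_mul (a * d - b * c)).div
      ((((D0 y h).const_mul c).add_const d).pow 2) (pow_ne_zero 2 hn)
    refine (this.congr_deriv ?_).deriv
    simp only [Pi.pow_apply]
    field_simp
    ring
  have E3 : deriv (deriv (deriv (fun y => (a * f y + b) / (c * f y + d)))) x =
      (a * d - b * c) * ((deriv (deriv (deriv f)) x * (c * f x + d)
        - 3 * c * deriv f x * deriv (deriv f) x) * (c * f x + d)
        - 3 * c * deriv f x * (deriv (deriv f) x * (c * f x + d) - 2 * c * deriv f x ^ 2)) /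
        (c * f x + d) ^ 4 := by
    rw [E2.deriv_eq]
    have h := h4
    have hn := hne
    have := ((((D2 x h).mul (((D0 x h).const_mul c).add_const d)).sub
      (((D1 x h).pow 2).const_mul (2 * c))).const_mul (a * d - b * c)).div
      ((((D0 x h).const_mul c).add_const d).pow 3) (pow_ne_zero 3 hn)
    refine (this.congr_deriv ?_).deriv
    simp only [Pi.pow_apply, Pi.mul_apply, Pi.sub_apply]
    field_simp
    ring
  unfold schwarzReal
  rw [E3, E2.eq_of_nhds, E1.eq_of_nhds]
  field_simp
  ring

theorem schwarzReal_coord_smul {f : ℝ → ℝ} {x : ℝ} (hf : ContDiffAt ℝ ∞ f x)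
    (hd : deriv f x ≠ 0) (B : GL (Fin 2) ℝ) (hB : B • ((f x : ℝ) : RP1) ≠ OnePoint.infty) :
    schwarzReal (fun y => coord (B • ((f y : ℝ) : RP1))) x = schwarzReal f x := by
  have hne : B 1 0 * f x + B 1 1 ≠ 0 := by
    intro h
    exact hB (by rw [OnePoint.smul_some_eq_ite, if_pos h])
  have hcont : ContinuousAt (fun y => B 1 0 * f y + B 1 1) x := by
    have := hf.continuousAt
    fun_prop
  have hdet : B 0 0 * B 1 1 - B 0 1 * B 1 0 ≠ 0 := by
    have := B.det_ne_zero
    rwa [Matrix.det_fin_two] at this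
  rw [← schwarzReal_mobius hf hd _ _ _ _ hdet hne]
  apply schwarzReal_congr
  filter_upwards [hcont.eventually_ne hne] with y hy
  rw [OnePoint.smul_some_eq_ite, if_neg hy]
  rfl

theorem schwarz_eq_local {φ : ℝ → RP1} {f : ℝ → ℝ} {x : ℝ} (hf : ContDiffAt ℝ ∞ f x)
    (hd : deriv f x ≠ 0) (g : GL (Fin 2) ℝ)
    (e : ∀ᶠ y in 𝓝 x, g • φ y = ((f y : ℝ) : RP1)) : schwarz φ x = schwarzReal f x := by
  have e' : ∀ᶠ y in 𝓝 x, φ y = g⁻¹ • ((f y : ℝ) : RP1) := by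
    filter_upwards [e] with y hy
    rw [← hy, inv_smul_smul]
  unfold schwarz
  split_ifs with h
  · have hB : (invGL * g⁻¹) • ((f x : ℝ) : RP1) ≠ OnePoint.infty := by
      rw [mul_smul, ← e'.self_of_nhds, h, OnePoint.smul_infty_eq_ite]
      simp [invGL, Matrix.GeneralLinearGroup.mkOfDetNeZero]
    rw [← schwarzReal_coord_smul hf hd _ hB]
    apply schwarzReal_congr
    filter_upwards [e'] with y hy
    rw [hy, mul_smul]
  · rw [e'.self_of_nhds] at h
    rw [← schwarzReal_coord_smul hf hd _ h]
    apply schwarzReal_congr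
    filter_upwards [e'] with y hy
    rw [hy]

/-- The Schwarzian derivative of an immersed curve is projectively invariant. -/
theorem schwarz_smul {φ : ℝ → RP1} (h : IsImmersion φ) (A : GL (Fin 2) ℝ) :
    schwarz (fun x => A • φ x) = schwarz φ := by
  funext x
  obtain ⟨g, f, hf, hd, e⟩ := h x
  rw [schwarz_eq_local hf hd g e]
  refine schwarz_eq_local hf hd (g * A⁻¹) ?_
  filter_upwards [e] with y hy
  rw [mul_smul, inv_smul_smul, hy]

/-! ### Projective structures on the circle `ℝ / 2πℤ` -/

/-- A developing map of a projective structure on the circle: an immersion of the universal cover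
`ℝ` in the projective line, equivariant with respect to some monodromy. -/
structure DevMap where
  toFun : ℝ → RP1
  immersion : IsImmersion toFun
  equivariant : ∃ T : GL (Fin 2) ℝ, ∀ x, toFun (x + 2 * Real.pi) = T • toFun x

/-- Two developing maps define the same projective structure when they differ by a homography. -/
instance devSetoid : Setoid DevMap where
  r φ ψ := ∃ A : GL (Fin 2) ℝ, ∀ x, ψ.toFun x = A • φ.toFun x
  iseqv :=
    { refl := fun φ => ⟨1, fun x => (one_smul _ _).symm⟩
      symm := fun {φ ψ} ⟨A, h⟩ => ⟨A⁻¹, fun x => by rw [h, inv_smul_smul]⟩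
      trans := fun {φ ψ χ} ⟨A, h⟩ ⟨B, k⟩ => ⟨B * A, fun x => by rw [k, h, mul_smul]⟩ }

/-- The space of projective structures on the circle. -/
abbrev ProjStr : Type := Quotient devSetoid

/-- The projective structure with developing map `φ`. -/
def DevMap.struct (φ : DevMap) : ProjStr := Quotient.mk devSetoid φ

/-- The Schwarzian derivative of (any developing map of) a projective structure. The space of
projective structures is an affine space over the quadratic differentials on the circle, and
`α ↦ α.schwarzian` is its affine coordinate. -/
def ProjStr.schwarzian (α : ProjStr) : ℝ → ℝ :=
  Quotient.lift (fun φ : DevMap => schwarz φ.toFun)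
    (by
      rintro φ ψ ⟨A, h⟩
      have e : ψ.toFun = fun x => A • φ.toFun x := funext h
      simp only [e, schwarz_smul φ.immersion A]) α

/-- The space of projective structures whose monodromy is the conjugacy class of `T` in
`PGL(2, ℝ)`: some developing map has monodromy exactly `T`. -/
def PT (T : GL (Fin 2) ℝ) : Type :=
  {α : ProjStr // ∃ φ : DevMap, φ.struct = α ∧ ∀ x, φ.toFun (x + 2 * Real.pi) = T • φ.toFun x}

/-! ### Vector fields and tangent vectors -/

/-- The smooth vector fields on the circle, as smooth `2π`-periodic functions. -/
def Vect : Submodule ℝ (ℝ → ℝ) where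
  carrier := {ξ | ContDiff ℝ ∞ ξ ∧ Function.Periodic ξ (2 * Real.pi)}
  add_mem' := fun h k => ⟨h.1.add k.1, h.2.add k.2⟩
  zero_mem' := ⟨contDiff_const, fun _ => rfl⟩
  smul_mem' := fun c _ h => ⟨contDiff_const.smul h.1, fun x => by simp [h.2 x]⟩

theorem hasDerivAt_iter {ξ : ℝ → ℝ} (h : ContDiff ℝ ∞ ξ) (n : ℕ) (x : ℝ) :
    HasDerivAt (deriv^[n] ξ) (deriv^[n + 1] ξ x) x := by
  have h1 : ContDiff ℝ ∞ (deriv^[n] ξ) := h.iterate_deriv n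
  rw [Function.iterate_succ_apply']
  exact (h1.differentiable (by simp) x).hasDerivAt

theorem iter_add {ξ η : ℝ → ℝ} (h : ContDiff ℝ ∞ ξ) (k : ContDiff ℝ ∞ η) (n : ℕ) :
    deriv^[n] (ξ + η) = deriv^[n] ξ + deriv^[n] η := by
  induction n with
  | zero => rfl
  | succ n ih =>
    funext x
    rw [Function.iterate_succ_apply', ih]
    exact ((hasDerivAt_iter h n x).add (hasDerivAt_iter k n x)).deriv

theorem iter_smul {ξ : ℝ → ℝ} (h : ContDiff ℝ ∞ ξ) (c : ℝ) (n : ℕ) :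
    deriv^[n] (c • ξ) = c • deriv^[n] ξ := by
  induction n with
  | zero => rfl
  | succ n ih =>
    funext x
    rw [Function.iterate_succ_apply', ih]
    exact ((hasDerivAt_iter h n x).const_mul c).deriv

/-- The infinitesimal action of vector fields on projective structures, in the affine coordinate
`q = S(φ)`: `L_ξ α = ξ q' + 2 ξ' q + ξ'''`, which is the derivative at `s = 0` of
`S(φ ∘ g_s) = (q ∘ g_s) g_s'² + S(g_s)` for a family of diffeomorphisms `g_s` of the circle that
starts at the identity with velocity `ξ`. -/
def ProjStr.lie (α : ProjStr) : Vect →ₗ[ℝ] (ℝ → ℝ) where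
  toFun ξ := fun x => ξ.1 x * deriv α.schwarzian x + 2 * deriv^[1] ξ.1 x * α.schwarzian x
    + deriv^[3] ξ.1 x
  map_add' := fun ξ η => by
    funext x
    simp only [Submodule.coe_add, iter_add ξ.2.1 η.2.1, Pi.add_apply]
    ring
  map_smul' := fun c ξ => by
    funext x
    simp only [Submodule.coe_smul, iter_smul ξ.2.1, Pi.smul_apply, smul_eq_mul, RingHom.id_apply]
    ring

/-- The tangent space at `α` of the space of structures with the same monodromy: the infinitesimal
variations `L_ξ α` of `α` by the vector fields of the circle. It is the quotient of `Vect` by the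
kernel of `ξ ↦ L_ξ α`, the Lie algebra of infinitesimal automorphisms of `α`. -/
abbrev ProjStr.Tangent (α : ProjStr) : Submodule ℝ (ℝ → ℝ) := LinearMap.range α.lie

/-- The tangent vector `L_ξ α`. -/
def ProjStr.vel (α : ProjStr) (ξ : Vect) : α.Tangent := α.lie.rangeRestrict ξ

/-! ### The integral defining the form -/

/-- The Lie derivative along `ξ d/dx` of the 1-form `θ dx`. -/
def lieForm (ξ θ : ℝ → ℝ) (x : ℝ) : ℝ := ξ x * deriv θ x + deriv ξ x * θ x

/-- The density of `(L_{ξ₁} θ / θ) d(L_{ξ₂} θ / θ)` on the line. -/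
def density (θ ξ₁ ξ₂ : ℝ → ℝ) (x : ℝ) : ℝ :=
  (lieForm ξ₁ θ x / θ x) * deriv (fun y => lieForm ξ₂ θ y / θ y) x

/-- The 1-form `θ = φ^* dt`, where `t = coord ∘ g` is the affine parameter of the projective line
attached to the homography `g`. -/
def pullForm (g : GL (Fin 2) ℝ) (φ : DevMap) : ℝ → ℝ := deriv (fun x => coord (g • φ.toFun x))

/-- The points where the parameter `t = coord ∘ g` is infinite along `φ`. -/
def poles (g : GL (Fin 2) ℝ) (φ : DevMap) : Set ℝ := {x | g • φ.toFun x = OnePoint.infty}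

/-- The interval `[a, b]` without the open `ε`-neighbourhood of `P`. -/
def excised (P : Set ℝ) (a b ε : ℝ) : Set ℝ := {x ∈ Set.Icc a b | ∀ p ∈ P, ε ≤ |x - p|}

/-- `l` is the Hadamard finite part of `∫_a^b f`, where `f` may be singular at the points of `P`:
the integral of `f` outside the `ε`-neighbourhood of `P` is a polynomial in `1 / ε` without constant
term, plus a quantity that tends to `l` as `ε` decreases to `0`. If `f` is integrable on `[a, b]`
and `P` is finite, this says that `l` is the integral of `f`. -/
def HasFinitePart (P : Set ℝ) (f : ℝ → ℝ) (a b l : ℝ) : Prop :=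
  (∀ ε > 0, IntegrableOn f (excised P a b ε)) ∧
  ∃ p : Polynomial ℝ, p.coeff 0 = 0 ∧
    Tendsto (fun ε : ℝ => (∫ x in excised P a b ε, f x) - p.eval ε⁻¹) (𝓝[>] 0) (𝓝 l)

/-- The value of `σ` on `L_{ξ₁} α` and `L_{ξ₂} α` is `∫ (L_{ξ₁} θ / θ) d(L_{ξ₂} θ / θ)`, for all
choices of the developing map, of the affine parameter, of the point `x₀` and of the vector fields
`ξ₁`, `ξ₂` vanishing at it. The circle is cut at `x₀`. -/
def IsGivenByIntegral {T : GL (Fin 2) ℝ} (σ : ∀ α : PT T, α.1.Tangent → α.1.Tangent → ℝ) : Prop :=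
  ∀ (α : PT T) (φ : DevMap), φ.struct = α.1 → ∀ (g : GL (Fin 2) ℝ) (x₀ : ℝ) (ξ₁ ξ₂ : Vect),
    ξ₁.1 x₀ = 0 → ξ₂.1 x₀ = 0 →
      HasFinitePart (poles g φ) (density (pullForm g φ) ξ₁.1 ξ₂.1) x₀ (x₀ + 2 * Real.pi)
        (σ α (α.1.vel ξ₁) (α.1.vel ξ₂))

/-! ### Closed forms -/

/-- A smooth three-parameter family in the space of structures with monodromy `T`: the structure
`F s` depends smoothly on `s`, and its partial derivatives are the tangent vectors
`∂ᵢ F = L_{ξᵢ} F`, with vector fields `ξᵢ` that depend smoothly on `s`. -/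
structure IsSmoothFamily {T : GL (Fin 2) ℝ} (F : (Fin 3 → ℝ) → PT T)
    (ξ : Fin 3 → (Fin 3 → ℝ) → Vect) : Prop where
  smooth : ContDiff ℝ ∞ (fun p : (Fin 3 → ℝ) × ℝ => (F p.1).1.schwarzian p.2)
  smooth_field : ∀ i, ContDiff ℝ ∞ (fun p : (Fin 3 → ℝ) × ℝ => (ξ i p.1).1 p.2)
  velocity : ∀ i s x,
    fderiv ℝ (fun r => (F r).1.schwarzian x) s (Pi.single i 1) = (F s).1.lie (ξ i s) x

/-- A 2-form is smooth and closed when its pull-back `∑ Ωᵢⱼ dsᵢ ∧ dsⱼ` by each smooth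
three-parameter family is smooth and closed. -/
def IsSmoothClosed {T : GL (Fin 2) ℝ} (σ : ∀ α : PT T, LinearMap.BilinForm ℝ α.1.Tangent) : Prop :=
  ∀ (F : (Fin 3 → ℝ) → PT T) (ξ : Fin 3 → (Fin 3 → ℝ) → Vect), IsSmoothFamily F ξ →
    ∀ Ω : Fin 3 → Fin 3 → (Fin 3 → ℝ) → ℝ,
      (∀ i j s, Ω i j s = σ (F s) ((F s).1.vel (ξ i s)) ((F s).1.vel (ξ j s))) →
      (∀ i j, ContDiff ℝ ∞ (Ω i j)) ∧
      ∀ s, fderiv ℝ (Ω 1 2) s (Pi.single 0 1) + fderiv ℝ (Ω 2 0) s (Pi.single 1 1)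
        + fderiv ℝ (Ω 0 1) s (Pi.single 2 1) = 0

end CircleProj

end

/-!
In an affine chart `t` the logarithmic derivative `ρ` of `θ = φ^*(dt)` solves the Riccati equation
`ρ' = q + ρ² / 2`, where `q` is the Schwarzian derivative of `φ`, and has residue `-2` at the points
where `t ∘ φ` is infinite. Hence the density of `ω` is the sum of the smooth density
`-q [ξ₁, ξ₂] + ξ₁' ξ₂''` and the derivative of an explicit potential, quadratic in `ρ`. The
potential tends to `0` at every common zero of `ξ₁` and `ξ₂`, poles included, so that the finite
part over a period that starts at such a zero is the ordinary integral of the smooth density. An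
integration by parts turns that integral into the pairing of the quadratic differential `L_ξ₁ α`
with the vector field `ξ₂`. The pairing is antisymmetric, so it descends to tangent vectors. It is
nondegenerate because a tangent vector, read as a vector field, pairs positively with itself. It is
closed because its exterior derivative reduces to the integral of the derivative of the Wronskian of
three vector fields.

Some automorphism of `α` does not vanish identically: a matrix that commutes with the monodromy and
is not scalar generates a vector field on the projective line, whose pull-back by `φ` is periodic.
Subtracting multiples of it makes vector fields vanish at a point where it does not.
-/

noncomputable section

namespace CircleProj

/-! ### Integrals with parameters -/

section Parametric

universe u

variable {E H : Type u} [NormedAddCommGroup E] [NormedAddCommGroup H]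

theorem exists_eventually_norm_le_on_uIcc {F : E × ℝ → H} (hF : Continuous F) (a b : ℝ) (s : E) :
    ∃ C, ∀ᶠ s' in 𝓝 s, ∀ x ∈ Set.uIcc a b, ‖F (s', x)‖ ≤ C := by
  obtain ⟨C, hC⟩ := (isCompact_uIcc (a := a) (b := b)).exists_bound_of_continuousOn
    (hF.comp (Continuous.prodMk_right s)).continuousOn
  refine ⟨C + 1, isCompact_uIcc.eventually_forall_of_forall_eventually fun x hx => ?_⟩
  filter_upwards [hF.norm.continuousAt.eventually_lt continuousAt_const
    ((hC x hx).trans_lt (lt_add_one C))] with p hp using hp.le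

variable [NormedSpace ℝ E] [NormedSpace ℝ H]

theorem hasFDerivAt_parametric_integral {F : E × ℝ → H} (hF : ContDiff ℝ 1 F) (a b : ℝ) (s : E) :
    HasFDerivAt (fun s => ∫ x in a..b, F (s, x))
      (∫ x in a..b, (fderiv ℝ F (s, x)).comp (ContinuousLinearMap.inl ℝ E ℝ)) s := by
  have hF' : Continuous fun p : E × ℝ =>
      (fderiv ℝ F p).comp (ContinuousLinearMap.inl ℝ E ℝ) := by
    have := hF.continuous_fderiv (by simp)
    fun_prop
  obtain ⟨C, hC⟩ := exists_eventually_norm_le_on_uIcc hF' a b s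
  refine intervalIntegral.hasFDerivAt_integral_of_dominated_of_fderiv_le
    (F' := fun s x => (fderiv ℝ F (s, x)).comp (ContinuousLinearMap.inl ℝ E ℝ))
    (bound := fun _ => C) hC ?_ ?_ ?_ ?_ intervalIntegrable_const ?_
  · exact Eventually.of_forall fun s' =>
      (hF.continuous.comp (Continuous.prodMk_right s')).aestronglyMeasurable
  · exact (hF.continuous.comp (Continuous.prodMk_right s)).intervalIntegrable _ _
  · exact (hF'.comp (Continuous.prodMk_right s)).aestronglyMeasurable
  · exact Eventually.of_forall fun x hx s' hs' => hs' x (Set.uIoc_subset_uIcc hx)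
  · exact Eventually.of_forall fun x _ s' _ =>
      (hF.differentiable (by simp) (s', x)).hasFDerivAt.comp s' (hasFDerivAt_prodMk_left s' x)

theorem contDiff_parametric_integral_nat (n : ℕ) :
    ∀ {H : Type u} [NormedAddCommGroup H] [NormedSpace ℝ H] {F : E × ℝ → H},
      ContDiff ℝ n F → ∀ a b : ℝ, ContDiff ℝ n fun s => ∫ x in a..b, F (s, x) := by
  induction n with
  | zero =>
    intro H _ _ F hF a b
    rw [Nat.cast_zero, contDiff_zero] at *
    exact intervalIntegral.continuous_parametric_intervalIntegral_of_continuous'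
      (f := fun s x => F (s, x)) hF a b
  | succ n ih =>
    intro H _ _ F hF a b
    have hF1 : ContDiff ℝ 1 F := hF.of_le (by norm_cast; omega)
    have hF' : ContDiff ℝ n (fun p => (fderiv ℝ F p).comp (ContinuousLinearMap.inl ℝ E ℝ)) :=
      (hF.fderiv_right (by norm_cast)).clm_comp contDiff_const
    push_cast
    rw [contDiff_succ_iff_hasFDerivAt]
    exact ⟨_, ih hF' a b, fun s => hasFDerivAt_parametric_integral hF1 a b s⟩

theorem contDiff_parametric_integral {F : E × ℝ → H} (hF : ContDiff ℝ ∞ F) (a b : ℝ) :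
    ContDiff ℝ ∞ fun s => ∫ x in a..b, F (s, x) :=
  contDiff_infty.2 fun n => contDiff_parametric_integral_nat n (contDiff_infty.1 hF n) a b

end Parametric

/-! ### Smooth functions of one variable -/

theorem contDiff_deriv {f : ℝ → ℝ} (hf : ContDiff ℝ ∞ f) : ContDiff ℝ ∞ (deriv f) :=
  hf.iterate_deriv 1

theorem hasDerivAt_of_contDiff {f : ℝ → ℝ} (hf : ContDiff ℝ ∞ f) (x : ℝ) :
    HasDerivAt f (deriv f x) x :=
  (hf.differentiable (by simp) x).hasDerivAt

theorem exists_hadamard_quotient {f : ℝ → ℝ} (hf : ContDiff ℝ ∞ f) (p : ℝ) :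
    ∃ h : ℝ → ℝ, ContDiff ℝ ∞ h ∧ h p = deriv f p ∧ ∀ x, f x = f p + (x - p) * h x := by
  have hf' := contDiff_deriv hf
  refine ⟨fun x => ∫ τ in (0 : ℝ)..1, deriv f (p + τ * (x - p)), ?_, by simp, fun x => ?_⟩
  · exact contDiff_parametric_integral (F := fun q : ℝ × ℝ => deriv f (p + q.2 * (q.1 - p)))
      (by fun_prop) 0 1
  · have line : ∀ τ, HasDerivAt (fun τ => f (p + τ * (x - p)))
        (deriv f (p + τ * (x - p)) * (x - p)) τ := fun τ =>
      (hasDerivAt_of_contDiff hf _).comp τ (by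
        simpa using ((hasDerivAt_id τ).mul_const (x - p)).const_add p)
    have ftc := intervalIntegral.integral_eq_sub_of_hasDerivAt (a := 0) (b := 1)
      (fun τ _ => line τ)
      (Continuous.intervalIntegrable (by have := hf'.continuous; fun_prop) _ _)
    rw [intervalIntegral.integral_mul_const] at ftc
    simp only [one_mul, add_sub_cancel, zero_mul, add_zero] at ftc
    linarith

theorem exists_contDiff_eventuallyEq {f : ℝ → ℝ} {p : ℝ}
    (hf : ∀ᶠ x in 𝓝 p, ContDiffAt ℝ ∞ f x) : ∃ F : ℝ → ℝ, ContDiff ℝ ∞ F ∧ F =ᶠ[𝓝 p] f := by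
  obtain ⟨δ, hδ, hball⟩ := Metric.eventually_nhds_iff_ball.1 hf
  let χ : ContDiffBump p := ⟨δ / 4, δ / 2, by positivity, by linarith⟩
  refine ⟨fun x => χ x * f x, contDiff_iff_contDiffAt.2 fun x => ?_, ?_⟩
  · by_cases hx : x ∈ Metric.ball p δ
    · exact χ.contDiff.contDiffAt.mul (hball x hx)
    · have hx' : x ∉ tsupport χ := fun h =>
        hx (Metric.closedBall_subset_ball (half_lt_self hδ) (χ.tsupport_eq.subset h))
      refine contDiffAt_const (c := 0).congr_of_eventuallyEq ?_
      filter_upwards [notMem_tsupport_iff_eventuallyEq.1 hx'] with y hy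
      simp [hy]
  · filter_upwards [χ.eventuallyEq_one] with x hx
    simp [hx]

/-! ### Constant terms and finite parts -/

/-- `v` is the constant term of `u` along `l` (a filter of neighbourhoods of `0`): up to a quantity
that tends to `v`, the function `u` is a polynomial in `1 / ε` without constant term. -/
def HasConstantTerm (l : Filter ℝ) (u : ℝ → ℝ) (v : ℝ) : Prop :=
  ∃ Q : Polynomial ℝ, Q.coeff 0 = 0 ∧ Tendsto (fun ε => u ε - Q.eval ε⁻¹) l (𝓝 v)

theorem coeff_zero_eq_of_tendsto_eval_inv {Q : Polynomial ℝ} {v : ℝ}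
    (h : Tendsto (fun ε : ℝ => Q.eval ε⁻¹) (𝓝[>] 0) (𝓝 v)) : Q.coeff 0 = v := by
  have atTop_lim : Tendsto (fun x => Q.eval x) atTop (𝓝 v) := by
    simpa only [Function.comp_def, inv_inv] using h.comp tendsto_inv_atTop_nhdsGT_zero
  obtain ⟨hv, hdeg⟩ := (Polynomial.tendsto_nhds_iff Q).1 atTop_lim
  rw [← hv, Polynomial.eq_C_of_degree_le_zero hdeg, Polynomial.leadingCoeff_C,
    Polynomial.coeff_C_zero]

namespace HasConstantTerm

variable {l : Filter ℝ} {u u' : ℝ → ℝ} {v v' : ℝ}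

theorem of_tendsto (h : Tendsto u l (𝓝 v)) : HasConstantTerm l u v :=
  ⟨0, by simp, by simpa using h⟩

theorem add (h : HasConstantTerm l u v) (h' : HasConstantTerm l u' v') :
    HasConstantTerm l (fun ε => u ε + u' ε) (v + v') := by
  obtain ⟨Q, hQ, hl⟩ := h
  obtain ⟨Q', hQ', hl'⟩ := h'
  refine ⟨Q + Q', by simp [hQ, hQ'], (hl.add hl').congr fun ε => ?_⟩
  rw [Polynomial.eval_add]
  ring

theorem neg (h : HasConstantTerm l u v) : HasConstantTerm l (fun ε => -u ε) (-v) := by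
  obtain ⟨Q, hQ, hl⟩ := h
  refine ⟨-Q, by simp [hQ], hl.neg.congr fun ε => ?_⟩
  rw [Polynomial.eval_neg]
  ring

theorem congr' (h : HasConstantTerm l u v) (e : u =ᶠ[l] u') : HasConstantTerm l u' v := by
  obtain ⟨Q, hQ, hl⟩ := h
  exact ⟨Q, hQ, hl.congr' (e.mono fun ε hε => by rw [hε])⟩

theorem comp_const_mul (h : HasConstantTerm (𝓝[≠] 0) u v) {c : ℝ} (hc : c ≠ 0) :
    HasConstantTerm (𝓝[>] 0) (fun ε => u (c * ε)) v := by
  obtain ⟨Q, hQ, hl⟩ := h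
  have scale : Tendsto (fun ε => c * ε) (𝓝[>] 0) (𝓝[≠] 0) := by
    refine tendsto_nhdsWithin_iff.2
      ⟨((continuous_const_mul c).tendsto' 0 0 (mul_zero c)).mono_left nhdsWithin_le_nhds, ?_⟩
    filter_upwards [self_mem_nhdsWithin] with ε hε using mul_ne_zero hc (ne_of_gt hε)
  refine ⟨Q.comp (Polynomial.C c⁻¹ * Polynomial.X), ?_, (hl.comp scale).congr fun ε => ?_⟩
  · simpa [Polynomial.coeff_zero_eq_eval_zero] using hQ
  · simp only [Polynomial.eval_comp, Polynomial.eval_mul, Polynomial.eval_C, Polynomial.eval_X,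
      Function.comp_apply, mul_inv]

theorem unique (h : HasConstantTerm (𝓝[>] 0) u v) (h' : HasConstantTerm (𝓝[>] 0) u v') :
    v = v' := by
  obtain ⟨Q, hQ, hl⟩ := h.add h'.neg
  have hcoeff := coeff_zero_eq_of_tendsto_eval_inv (Q := -Q)
    ((hl.congr fun ε => by rw [Polynomial.eval_neg]; ring))
  rw [Polynomial.coeff_neg, hQ] at hcoeff
  linarith

end HasConstantTerm

theorem exists_hasConstantTerm_div_pow {h : ℝ → ℝ} (hh : ContDiff ℝ ∞ h) (p : ℝ) (n : ℕ) :
    ∃ v, HasConstantTerm (𝓝[≠] 0) (fun ε => h (p + ε) / ε ^ n) v := by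
  induction n generalizing h with
  | zero =>
    refine ⟨h p, .of_tendsto ?_⟩
    simp only [pow_zero, div_one]
    exact ((hh.continuous.comp (continuous_const_add p)).tendsto' 0 _ (by simp)).mono_left
      nhdsWithin_le_nhds
  | succ n ih =>
    obtain ⟨k, hk, -, quotient⟩ := exists_hadamard_quotient hh p
    obtain ⟨v, hv⟩ := ih hk
    have leading : HasConstantTerm (𝓝[≠] 0) (fun ε => h p / ε ^ (n + 1)) 0 :=
      ⟨Polynomial.C (h p) * Polynomial.X ^ (n + 1), by simp, by simp [div_eq_mul_inv]⟩
    refine ⟨0 + v, (leading.add hv).congr' ?_⟩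
    filter_upwards [self_mem_nhdsWithin] with ε (hε : ε ≠ 0)
    rw [quotient (p + ε), add_sub_cancel_left, add_div, pow_succ', mul_div_mul_left _ _ hε]

/-- The points at distance at least `ε` from `P`. -/
def farFrom (P : Set ℝ) (ε : ℝ) : Set ℝ := {x | ∀ p ∈ P, ε ≤ |x - p|}

theorem isClosed_farFrom (P : Set ℝ) (ε : ℝ) : IsClosed (farFrom P ε) := by
  simp only [farFrom, Set.ofPred_forall]
  exact isClosed_biInter fun p _ => isClosed_le continuous_const (by fun_prop)

theorem farFrom_subset_compl (P : Set ℝ) {ε : ℝ} (hε : 0 < ε) : farFrom P ε ⊆ Pᶜ :=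
  fun x hx hxP => (hx x hxP).not_gt (by simpa using hε)

/-- The version of `HasFinitePart` for oriented intervals: the integral is the interval integral
`∫ x in a..b`, so that `a ≤ b` is not needed and finite parts are additive. -/
def HasIntervalFinitePart (P : Set ℝ) (f : ℝ → ℝ) (a b v : ℝ) : Prop :=
  (∀ ε > 0, IntervalIntegrable ((farFrom P ε).indicator f) volume a b) ∧
    HasConstantTerm (𝓝[>] 0) (fun ε => ∫ x in a..b, (farFrom P ε).indicator f x) v

theorem hasFinitePart_iff_interval {P : Set ℝ} {f : ℝ → ℝ} {a b v : ℝ} (hab : a ≤ b) :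
    HasFinitePart P f a b v ↔ HasIntervalFinitePart P f a b v := by
  have hmeas := fun ε => (isClosed_farFrom P ε).measurableSet
  have hexcised : ∀ ε, excised P a b ε = Set.Icc a b ∩ farFrom P ε := fun ε => rfl
  have hint : ∀ ε, IntegrableOn f (excised P a b ε) ↔
      IntervalIntegrable ((farFrom P ε).indicator f) volume a b := fun ε => by
    rw [intervalIntegrable_iff_integrableOn_Icc_of_le hab, hexcised, Set.inter_comm,
      integrableOn_indicator_iff (hmeas ε)]
  have heq : ∀ ε, ∫ x in a..b, (farFrom P ε).indicator f x = ∫ x in excised P a b ε, f x :=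
    fun ε => by
      rw [intervalIntegral.integral_of_le hab, ← integral_Icc_eq_integral_Ioc,
        setIntegral_indicator (hmeas ε), hexcised]
  simp only [HasFinitePart, HasIntervalFinitePart, HasConstantTerm, hint, heq]

theorem HasFinitePart.unique {P : Set ℝ} {f : ℝ → ℝ} {a b v v' : ℝ}
    (h : HasFinitePart P f a b v) (h' : HasFinitePart P f a b v') : v = v' :=
  HasConstantTerm.unique h.2 h'.2

namespace HasIntervalFinitePart

variable {P : Set ℝ} {f : ℝ → ℝ} {a b c v w : ℝ}

theorem symm (h : HasIntervalFinitePart P f a b v) : HasIntervalFinitePart P f b a (-v) :=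
  ⟨fun ε hε => (h.1 ε hε).symm, h.2.neg.congr' (.of_forall fun _ =>
    (intervalIntegral.integral_symm a b).symm)⟩

theorem trans (h : HasIntervalFinitePart P f a b v) (h' : HasIntervalFinitePart P f b c w) :
    HasIntervalFinitePart P f a c (v + w) := by
  refine ⟨fun ε hε => (h.1 ε hε).trans (h'.1 ε hε), (h.2.add h'.2).congr' ?_⟩
  filter_upwards [self_mem_nhdsWithin] with ε hε
  exact intervalIntegral.integral_add_adjacent_intervals (h.1 ε hε) (h'.1 ε hε)

end HasIntervalFinitePart

theorem ae_notMem_of_compl_mem_codiscrete {P : Set ℝ} (hP : Pᶜ ∈ codiscrete ℝ) :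
    ∀ᵐ x, x ∉ P := by
  rw [← Measure.restrict_univ (μ := volume)]
  exact ae_restrict_le_codiscreteWithin MeasurableSet.univ hP

theorem hasIntervalFinitePart_of_intervalIntegrable {P : Set ℝ} {f : ℝ → ℝ} {a b : ℝ}
    (hP : Pᶜ ∈ codiscrete ℝ) (hf : IntervalIntegrable f volume a b) :
    HasIntervalFinitePart P f a b (∫ x in a..b, f x) := by
  have hmeas := fun ε => (isClosed_farFrom P ε).measurableSet
  have hint : ∀ ε, IntervalIntegrable ((farFrom P ε).indicator f) volume a b := fun ε =>
    ⟨hf.1.indicator (hmeas ε), hf.2.indicator (hmeas ε)⟩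
  refine ⟨fun ε _ => hint ε, .of_tendsto ?_⟩
  refine intervalIntegral.tendsto_integral_filter_of_dominated_convergence (fun x => ‖f x‖)
    (.of_forall fun ε => (hint ε).def'.aestronglyMeasurable)
    (.of_forall fun ε => .of_forall fun x _ => norm_indicator_le_norm_self _ _) hf.norm ?_
  filter_upwards [ae_notMem_of_compl_mem_codiscrete hP] with x hx _
  obtain ⟨δ, hδ, hball⟩ := Metric.isOpen_iff.1 (mem_codiscrete'.1 hP).1 x hx
  refine tendsto_const_nhds.congr' ?_
  filter_upwards [Ioo_mem_nhdsGT hδ] with ε hε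
  have hfar : x ∈ farFrom P ε := fun p hp =>
    hε.2.le.trans (not_lt.1 fun h => hball (by rwa [Metric.mem_ball, dist_comm, Real.dist_eq]) hp)
  rw [Set.indicator_of_mem hfar]

theorem intervalIntegrable_indicator_farFrom {P : Set ℝ} {f : ℝ → ℝ} (hf : ContinuousOn f Pᶜ)
    {ε : ℝ} (hε : 0 < ε) (a b : ℝ) :
    IntervalIntegrable ((farFrom P ε).indicator f) volume a b := by
  have hcompact := isCompact_uIcc (a := a) (b := b) |>.inter_left (isClosed_farFrom P ε)
  have hint := (hf.mono (Set.inter_subset_left.trans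
    (farFrom_subset_compl P hε))).integrableOn_compact (μ := volume) hcompact
  rw [← integrableOn_indicator_iff (isClosed_farFrom P ε).measurableSet] at hint
  exact intervalIntegrable_iff.2 (hint.mono_set Set.uIoc_subset_uIcc)

section Primitive

variable {P : Set ℝ} {f W : ℝ → ℝ}

theorem eventually_hasIntervalFinitePart_of_notMem (hP : Pᶜ ∈ codiscrete ℝ)
    (hf : ContinuousOn f Pᶜ) (hW : ∀ x ∉ P, HasDerivAt W (f x) x) {x : ℝ} (hx : x ∉ P) :
    ∀ᶠ y in 𝓝 x, y ∉ P ∧ HasIntervalFinitePart P f x y (W y - W x) := by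
  obtain ⟨δ, hδ, hball⟩ := Metric.isOpen_iff.1 (mem_codiscrete'.1 hP).1 x hx
  filter_upwards [Metric.ball_mem_nhds x hδ] with y hy
  have hsub : Set.uIcc x y ⊆ Pᶜ := by
    rw [← segment_eq_uIcc]
    exact ((convex_ball x δ).segment_subset (Metric.mem_ball_self hδ) hy).trans hball
  have hint := (hf.mono hsub).intervalIntegrable (μ := volume)
  refine ⟨hball hy, ?_⟩
  rw [← intervalIntegral.integral_eq_sub_of_hasDerivAt (fun z hz => hW z (hsub hz)) hint]
  exact hasIntervalFinitePart_of_intervalIntegrable hP hint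

theorem uIcc_subset_farFrom {p u r ε : ℝ} (hu : |u| = 1) (hε : 0 < ε) (hεr : ε < r)
    (hisol : ∀ p' ∈ P, |p' - p| < 2 * r → p' = p) :
    Set.uIcc (p + u * ε) (p + u * r) ⊆ farFrom P ε := by
  have annulus : ∀ x ∈ Set.uIcc (p + u * ε) (p + u * r), ε ≤ |x - p| ∧ |x - p| ≤ r := by
    intro x hx
    rcases eq_or_eq_neg_of_abs_eq hu with rfl | rfl
    · rw [Set.uIcc_of_le (by linarith), Set.mem_Icc] at hx
      rw [abs_of_pos (by linarith)]
      constructor <;> linarith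
    · rw [Set.uIcc_of_ge (by linarith), Set.mem_Icc] at hx
      rw [abs_of_neg (by linarith)]
      constructor <;> linarith
  intro x hx p' hp'
  by_cases hpp' : |p' - p| < 2 * r
  · exact hisol p' hp' hpp' ▸ (annulus x hx).1
  · have := abs_sub_le p' x p
    rw [abs_sub_comm p' x] at this
    linarith [(annulus x hx).2]

/-- The sign `u` is the side of `p` on which the integral is taken. -/
theorem integral_indicator_farFrom {p u r ε : ℝ} (hf : ContinuousOn f Pᶜ)
    (hW : ∀ x ∉ P, HasDerivAt W (f x) x) (hp : p ∈ P) (hu : |u| = 1) (hε : 0 < ε) (hεr : ε < r)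
    (hisol : ∀ p' ∈ P, |p' - p| < 2 * r → p' = p) :
    ∫ x in p..(p + u * r), (farFrom P ε).indicator f x = W (p + u * r) - W (p + u * ε) := by
  have hfar := uIcc_subset_farFrom hu hε hεr hisol
  set c := p + u * ε with hc
  set y := p + u * r with hy
  have near : ∀ x ∈ Set.uIoc p c, x ≠ c → |x - p| < ε := by
    intro x hx hxc
    have hx' := Set.uIoc_subset_uIcc hx
    rcases eq_or_eq_neg_of_abs_eq hu with rfl | rfl
    · rw [Set.uIcc_of_le (by linarith), Set.mem_Icc] at hx'
      rw [abs_lt]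
      constructor <;> linarith [lt_of_le_of_ne hx'.2 hxc]
    · rw [Set.uIcc_of_ge (by linarith), Set.mem_Icc] at hx'
      rw [abs_lt]
      constructor <;> linarith [lt_of_le_of_ne hx'.1 hxc.symm]
  have hint := (hf.mono (hfar.trans (farFrom_subset_compl P hε))).intervalIntegrable
    (μ := volume)
  have vanish : ∫ x in p..c, (farFrom P ε).indicator f x = 0 := by
    refine intervalIntegral.integral_zero_ae ?_
    filter_upwards [Measure.ae_ne volume c] with x hxc hx
    exact Set.indicator_of_notMem (fun h => (h p hp).not_gt (near x hx hxc)) f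
  have keep : ∫ x in c..y, (farFrom P ε).indicator f x = W y - W c := by
    rw [← intervalIntegral.integral_eq_sub_of_hasDerivAt
      (fun z hz => hW z (farFrom_subset_compl P hε (hfar hz))) hint]
    exact intervalIntegral.integral_congr fun x hx => Set.indicator_of_mem (hfar hx) f
  rw [← intervalIntegral.integral_add_adjacent_intervals
    (intervalIntegrable_indicator_farFrom hf hε p c)
    (intervalIntegrable_indicator_farFrom hf hε c y), vanish, keep, zero_add]

theorem eventually_hasIntervalFinitePart_of_mem (hP : Pᶜ ∈ codiscrete ℝ)
    (hf : ContinuousOn f Pᶜ) (hW : ∀ x ∉ P, HasDerivAt W (f x) x) {p v : ℝ} (hp : p ∈ P)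
    (hv : HasConstantTerm (𝓝[≠] 0) (fun ε => W (p + ε)) v) :
    ∀ᶠ y in 𝓝[≠] p, y ∉ P ∧ HasIntervalFinitePart P f p y (W y - v) := by
  have hisol : ∀ᶠ y in 𝓝[≠] p, y ∉ P :=
    compl_compl P ▸ disjoint_principal_right.1 (mem_codiscrete.1 hP p)
  obtain ⟨δ, hδ, hball⟩ := Metric.eventually_nhds_iff_ball.1 (eventually_nhdsWithin_iff.1 hisol)
  filter_upwards [hisol, self_mem_nhdsWithin,
    nhdsWithin_le_nhds (Metric.ball_mem_nhds p (half_pos hδ))] with y hyP (hyp : y ≠ p) hy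
  rw [Metric.mem_ball, Real.dist_eq] at hy
  refine ⟨hyP, fun ε hε => intervalIntegrable_indicator_farFrom hf hε p y, ?_⟩
  obtain ⟨u, hu, hyu⟩ : ∃ u : ℝ, |u| = 1 ∧ y = p + u * |y - p| := by
    have : |y - p| ≠ 0 := abs_ne_zero.2 (sub_ne_zero.2 hyp)
    exact ⟨(y - p) / |y - p|, by rw [abs_div, abs_abs, div_self this], by field_simp; ring⟩
  refine ((HasConstantTerm.of_tendsto (tendsto_const_nhds (x := W y))).add
    (hv.comp_const_mul (abs_ne_zero.1 (hu ▸ one_ne_zero))).neg).congr' ?_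
  filter_upwards [Ioo_mem_nhdsGT (abs_pos.2 (sub_ne_zero.2 hyp))] with ε hε
  have := integral_indicator_farFrom hf hW hp hu hε.1 hε.2 fun p' hp' hlt => by
    by_contra hne
    exact hball p' (by rw [Metric.mem_ball, Real.dist_eq]; linarith) hne hp'
  rw [← hyu] at this
  rw [this, sub_eq_add_neg]

theorem hasFinitePart_of_hasConstantTerm (hP : Pᶜ ∈ codiscrete ℝ) (hf : ContinuousOn f Pᶜ)
    (hW : ∀ x ∉ P, HasDerivAt W (f x) x)
    (hV : ∀ p, ∃ v, HasConstantTerm (𝓝[≠] 0) (fun ε => W (p + ε)) v) {a b va vb : ℝ}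
    (hab : a ≤ b) (ha : HasConstantTerm (𝓝[≠] 0) (fun ε => W (a + ε)) va)
    (hb : HasConstantTerm (𝓝[≠] 0) (fun ε => W (b + ε)) vb) :
    HasFinitePart P f a b (vb - va) := by
  choose V hV using hV
  have huniq : ∀ {p v}, HasConstantTerm (𝓝[≠] 0) (fun ε => W (p + ε)) v → v = V p :=
    fun {p v} h => (h.comp_const_mul one_ne_zero).unique ((hV p).comp_const_mul one_ne_zero)
  have hVW : ∀ x ∉ P, W x = V x := fun x hx => huniq (.of_tendsto
    (((hW x hx).continuousAt.tendsto.comp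
      ((continuous_const_add x).tendsto' 0 x (add_zero x))).mono_left nhdsWithin_le_nhds))
  have local_rel : ∀ x, ∀ᶠ y in 𝓝 x, HasIntervalFinitePart P f x y (V y - V x) := by
    intro x
    by_cases hx : x ∈ P
    · have self_rel : HasIntervalFinitePart P f x x (V x - V x) := by
        simpa using hasIntervalFinitePart_of_intervalIntegrable hP (IntervalIntegrable.refl)
      rw [← nhdsNE_sup_pure, eventually_sup, eventually_pure]
      refine ⟨?_, self_rel⟩
      filter_upwards [eventually_hasIntervalFinitePart_of_mem hP hf hW hx (hV x)] with y ⟨hy, h⟩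
      rwa [← hVW y hy]
    · filter_upwards [eventually_hasIntervalFinitePart_of_notMem hP hf hW hx] with y ⟨hy, h⟩
      rwa [← hVW x hx, ← hVW y hy]
  rw [hasFinitePart_iff_interval hab, huniq ha, huniq hb]
  refine PreconnectedSpace.induction₂' (fun x y => HasIntervalFinitePart P f x y (V y - V x))
    (fun x => (local_rel x).mono fun y h => ⟨h, by simpa using h.symm⟩)
    ⟨fun x y z h h' => by simpa using h.trans h'⟩ a b

end Primitive

/-! ### The density of a Riccati form -/

/-- A 1-form `θ dx` that behaves like the differential of an affine parameter of a projective
structure with Schwarzian derivative `q`: outside a discrete closed set `P` its logarithmic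
derivative solves the Riccati equation `ρ' = q + ρ² / 2`, and at the points of `P` it has simple
poles with residue `-2`. -/
structure IsRiccatiForm (P : Set ℝ) (q θ : ℝ → ℝ) : Prop where
  compl_mem_codiscrete : Pᶜ ∈ codiscrete ℝ
  ne_zero : ∀ x ∉ P, θ x ≠ 0
  hasDerivAt_logDeriv : ∀ x ∉ P, HasDerivAt (logDeriv θ) (q x + logDeriv θ x ^ 2 / 2) x
  exists_residue : ∀ p ∈ P, ∃ M : ℝ → ℝ, ContDiff ℝ ∞ M ∧ M p = -2 ∧
    ∀ᶠ x in 𝓝[≠] p, logDeriv θ x = M x / (x - p)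

/-- The bracket of the vector fields `ξ₁ d/dx` and `ξ₂ d/dx` on the line. -/
def fieldBracket (ξ₁ ξ₂ : ℝ → ℝ) (x : ℝ) : ℝ := ξ₁ x * deriv ξ₂ x - deriv ξ₁ x * ξ₂ x

/-- The density of the 2-form in terms of the Schwarzian derivative `q`. It is smooth, and differs
from `density` by a total derivative. -/
def baseDensity (q ξ₁ ξ₂ : ℝ → ℝ) (x : ℝ) : ℝ :=
  -(q x * fieldBracket ξ₁ ξ₂ x) + deriv ξ₁ x * deriv (deriv ξ₂) x

/-- A primitive of `density - baseDensity`, for a 1-form with logarithmic derivative `ρ`. -/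
def potential (ρ ξ₁ ξ₂ : ℝ → ℝ) (x : ℝ) : ℝ :=
  ρ x * (ξ₁ x * deriv ξ₂ x) + ρ x ^ 2 / 2 * (ξ₁ x * ξ₂ x)

theorem lieForm_div {θ : ℝ → ℝ} (ξ : ℝ → ℝ) {x : ℝ} (hx : θ x ≠ 0) :
    lieForm ξ θ x / θ x = ξ x * logDeriv θ x + deriv ξ x := by
  rw [lieForm, logDeriv_apply, add_div, mul_div_assoc, mul_div_cancel_right₀ _ hx]

theorem continuous_baseDensity {q ξ₁ ξ₂ : ℝ → ℝ} (hq : Continuous q) (h₁ : ContDiff ℝ ∞ ξ₁)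
    (h₂ : ContDiff ℝ ∞ ξ₂) : Continuous (baseDensity q ξ₁ ξ₂) := by
  have := contDiff_deriv h₁
  have := contDiff_deriv h₂
  have := contDiff_deriv (contDiff_deriv h₂)
  unfold baseDensity fieldBracket
  fun_prop

theorem tendsto_const_add_nhdsNE (p : ℝ) : Tendsto (fun ε => p + ε) (𝓝[≠] 0) (𝓝[≠] p) := by
  have h := ((Homeomorph.addLeft p).map_punctured_nhds_eq 0).le
  simp only [Homeomorph.coe_addLeft, add_zero] at h
  exact h

theorem intervalIntegrable_of_tendsto_nhdsNE {P : Set ℝ} {f : ℝ → ℝ} {a b : ℝ}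
    (hP : Pᶜ ∈ codiscrete ℝ) (hf : ContinuousOn f Pᶜ)
    (hlim : ∀ x ∈ Set.uIcc a b, ∃ v, Tendsto f (𝓝[≠] x) (𝓝 v)) :
    IntervalIntegrable f volume a b := by
  have hmeas : AEStronglyMeasurable f volume := by
    rw [← Measure.restrict_eq_self_of_ae_mem (ae_notMem_of_compl_mem_codiscrete hP)]
    exact hf.aestronglyMeasurable (mem_codiscrete'.1 hP).1.measurableSet
  have hloc : LocallyIntegrableOn f (Set.uIcc a b) volume := by
    intro x hx
    obtain ⟨v, hv⟩ := hlim x hx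
    have hle : 𝓝 x ⊓ ae volume ≤ 𝓝[≠] x :=
      inf_le_inf le_rfl (le_principal_iff.2 (compl_mem_ae_iff.2 (measure_singleton x)))
    have hat : IntegrableAtFilter f (𝓝 x) volume :=
      (volume.finiteAt_nhds x).integrableAtFilter_of_tendsto_ae
        ⟨Set.univ, univ_mem, hmeas.restrict⟩ (hv.mono_left hle)
    exact hat.filter_mono nhdsWithin_le_nhds
  exact (hloc.integrableOn_isCompact isCompact_uIcc).intervalIntegrable

namespace IsRiccatiForm

variable {P : Set ℝ} {q θ ξ₁ ξ₂ : ℝ → ℝ}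

theorem eventually_notMem (h : IsRiccatiForm P q θ) (x : ℝ) : ∀ᶠ y in 𝓝[≠] x, y ∉ P :=
  compl_compl P ▸ disjoint_principal_right.1 (mem_codiscrete.1 h.compl_mem_codiscrete x)

theorem compl_mem_nhds (h : IsRiccatiForm P q θ) {x : ℝ} (hx : x ∉ P) : Pᶜ ∈ 𝓝 x :=
  (mem_codiscrete'.1 h.compl_mem_codiscrete).1.mem_nhds hx

theorem density_eq (h : IsRiccatiForm P q θ) (ξ₁ : ℝ → ℝ) (h₂ : ContDiff ℝ ∞ ξ₂) {x : ℝ}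
    (hx : x ∉ P) :
    density θ ξ₁ ξ₂ x = (ξ₁ x * logDeriv θ x + deriv ξ₁ x) *
      (deriv ξ₂ x * logDeriv θ x + ξ₂ x * (q x + logDeriv θ x ^ 2 / 2) +
        deriv (deriv ξ₂) x) := by
  have quotient : (fun y => lieForm ξ₂ θ y / θ y) =ᶠ[𝓝 x]
      fun y => ξ₂ y * logDeriv θ y + deriv ξ₂ y := by
    filter_upwards [h.compl_mem_nhds hx] with y hy using lieForm_div ξ₂ (h.ne_zero y hy)
  have deriv_quotient := ((hasDerivAt_of_contDiff h₂ x).mul (h.hasDerivAt_logDeriv x hx)).add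
    (hasDerivAt_of_contDiff (contDiff_deriv h₂) x)
  rw [density, lieForm_div ξ₁ (h.ne_zero x hx), quotient.deriv_eq]
  exact congrArg _ deriv_quotient.deriv

theorem continuousOn_density (h : IsRiccatiForm P q θ) (hq : Continuous q)
    (h₁ : ContDiff ℝ ∞ ξ₁) (h₂ : ContDiff ℝ ∞ ξ₂) : ContinuousOn (density θ ξ₁ ξ₂) Pᶜ := by
  have hρ : ContinuousOn (logDeriv θ) Pᶜ := fun x hx =>
    (h.hasDerivAt_logDeriv x hx).continuousAt.continuousWithinAt
  have := h₁.continuous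
  have := h₂.continuous
  have := (contDiff_deriv h₁).continuous
  have := (contDiff_deriv h₂).continuous
  have := (contDiff_deriv (contDiff_deriv h₂)).continuous
  exact ContinuousOn.congr (by fun_prop) fun x hx => h.density_eq ξ₁ h₂ hx

theorem hasDerivAt_potential (h : IsRiccatiForm P q θ) (h₁ : ContDiff ℝ ∞ ξ₁)
    (h₂ : ContDiff ℝ ∞ ξ₂) {x : ℝ} (hx : x ∉ P) :
    HasDerivAt (potential (logDeriv θ) ξ₁ ξ₂)
      (density θ ξ₁ ξ₂ x - baseDensity q ξ₁ ξ₂ x) x := by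
  have hρ := h.hasDerivAt_logDeriv x hx
  have d₁ := hasDerivAt_of_contDiff h₁ x
  have d₂ := hasDerivAt_of_contDiff h₂ x
  have dd₂ := hasDerivAt_of_contDiff (contDiff_deriv h₂) x
  refine ((hρ.mul (d₁.mul dd₂)).add (((hρ.pow 2).div_const 2).mul (d₁.mul d₂))).congr_deriv ?_
  simp only [h.density_eq ξ₁ h₂ hx, baseDensity, fieldBracket, Pi.mul_apply, Pi.pow_apply]
  ring

theorem tendsto_potential_of_notMem (h : IsRiccatiForm P q θ) (h₁ : ContDiff ℝ ∞ ξ₁)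
    (h₂ : ContDiff ℝ ∞ ξ₂) {x : ℝ} (hx : x ∉ P) :
    Tendsto (potential (logDeriv θ) ξ₁ ξ₂) (𝓝[≠] x) (𝓝 (potential (logDeriv θ) ξ₁ ξ₂ x)) :=
  (h.hasDerivAt_potential h₁ h₂ hx).continuousAt.tendsto.mono_left nhdsWithin_le_nhds

theorem exists_hasConstantTerm_potential (h : IsRiccatiForm P q θ) (h₁ : ContDiff ℝ ∞ ξ₁)
    (h₂ : ContDiff ℝ ∞ ξ₂) (p : ℝ) :
    ∃ v, HasConstantTerm (𝓝[≠] 0) (fun ε => potential (logDeriv θ) ξ₁ ξ₂ (p + ε)) v := by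
  by_cases hp : p ∈ P
  · obtain ⟨M, hM, -, hρ⟩ := h.exists_residue p hp
    have := contDiff_deriv h₂
    obtain ⟨v, hv⟩ := exists_hasConstantTerm_div_pow
      (h := fun x => M x * (ξ₁ x * deriv ξ₂ x)) (by fun_prop) p 1
    obtain ⟨w, hw⟩ := exists_hasConstantTerm_div_pow
      (h := fun x => M x ^ 2 / 2 * (ξ₁ x * ξ₂ x)) (by fun_prop) p 2
    refine ⟨v + w, (hv.add hw).congr' ?_⟩
    filter_upwards [(tendsto_const_add_nhdsNE p).eventually hρ] with ε hε
    rw [potential, hε, add_sub_cancel_left]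
    ring
  · exact ⟨_, .of_tendsto
      ((h.tendsto_potential_of_notMem h₁ h₂ hp).comp (tendsto_const_add_nhdsNE p))⟩

/-- The residue `-2` makes the two terms of the potential compensate each other. -/
theorem tendsto_potential_of_eq_zero (h : IsRiccatiForm P q θ) (h₁ : ContDiff ℝ ∞ ξ₁)
    (h₂ : ContDiff ℝ ∞ ξ₂) {p : ℝ} (hp₁ : ξ₁ p = 0) (hp₂ : ξ₂ p = 0) :
    Tendsto (potential (logDeriv θ) ξ₁ ξ₂) (𝓝[≠] p) (𝓝 0) := by
  by_cases hp : p ∈ P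
  · obtain ⟨M, hM, hMp, hρ⟩ := h.exists_residue p hp
    obtain ⟨η₁, hη₁, -, quotient₁⟩ := exists_hadamard_quotient h₁ p
    obtain ⟨η₂, hη₂, hη₂p, quotient₂⟩ := exists_hadamard_quotient h₂ p
    have hd₂ := contDiff_deriv h₂
    have lim : Tendsto (fun x => M x * (η₁ x * deriv ξ₂ x) + M x ^ 2 / 2 * (η₁ x * η₂ x))
        (𝓝[≠] p) (𝓝 0) := by
      refine (Continuous.tendsto' (by fun_prop) p 0 ?_).mono_left nhdsWithin_le_nhds
      rw [hMp, hη₂p]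
      ring
    refine lim.congr' ?_
    filter_upwards [hρ, self_mem_nhdsWithin] with x hx (hxp : x ≠ p)
    have hxp' : x - p ≠ 0 := sub_ne_zero.2 hxp
    rw [potential, hx, quotient₁ x, quotient₂ x, hp₁, hp₂]
    field_simp
    ring
  · have := h.tendsto_potential_of_notMem h₁ h₂ hp
    rwa [potential, hp₁, zero_mul, mul_zero, zero_mul, mul_zero, add_zero] at this

theorem hasFinitePart_density (h : IsRiccatiForm P q θ) (hq : Continuous q)
    (h₁ : ContDiff ℝ ∞ ξ₁) (h₂ : ContDiff ℝ ∞ ξ₂) {a b : ℝ} (hab : a ≤ b)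
    (ha₁ : ξ₁ a = 0) (ha₂ : ξ₂ a = 0) (hb₁ : ξ₁ b = 0) (hb₂ : ξ₂ b = 0) :
    HasFinitePart P (density θ ξ₁ ξ₂) a b (∫ x in a..b, baseDensity q ξ₁ ξ₂ x) := by
  have hbase := continuous_baseDensity hq h₁ h₂
  set B : ℝ → ℝ := fun x => ∫ y in a..x, baseDensity q ξ₁ ξ₂ y
  have hB : ∀ x, HasDerivAt B (baseDensity q ξ₁ ξ₂ x) x := fun x =>
    (hbase.integral_hasStrictDerivAt a x).hasDerivAt
  have hBconst : ∀ p, HasConstantTerm (𝓝[≠] 0) (fun ε => B (p + ε)) (B p) := fun p =>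
    .of_tendsto (((hB p).continuousAt.tendsto.mono_left nhdsWithin_le_nhds).comp
      (tendsto_const_add_nhdsNE p))
  have const_of_zero : ∀ p, ξ₁ p = 0 → ξ₂ p = 0 → HasConstantTerm (𝓝[≠] 0)
      (fun ε => potential (logDeriv θ) ξ₁ ξ₂ (p + ε) + B (p + ε)) (0 + B p) :=
    fun p hp₁ hp₂ => HasConstantTerm.add (.of_tendsto
      ((h.tendsto_potential_of_eq_zero h₁ h₂ hp₁ hp₂).comp (tendsto_const_add_nhdsNE p)))
      (hBconst p)
  have finitePart := hasFinitePart_of_hasConstantTerm h.compl_mem_codiscrete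
    (h.continuousOn_density hq h₁ h₂)
    (fun x hx => ((h.hasDerivAt_potential h₁ h₂ hx).add (hB x)).congr_deriv (sub_add_cancel _ _))
    (fun p => (h.exists_hasConstantTerm_potential h₁ h₂ p).imp' _ fun v hv => hv.add (hBconst p))
    hab (const_of_zero a ha₁ ha₂) (const_of_zero b hb₁ hb₂)
  simpa [B] using finitePart

theorem exists_tendsto_density (h : IsRiccatiForm P q θ) (h₁ : ContDiff ℝ ∞ ξ₁)
    (h₂ : ContDiff ℝ ∞ ξ₂) {p : ℝ} (hp : p ∈ P) (hp₁ : ξ₁ p = 0) (hp₂ : ξ₂ p = 0) :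
    ∃ v, Tendsto (density θ ξ₁ ξ₂) (𝓝[≠] p) (𝓝 v) := by
  have smooth_quotient : ∀ {ξ : ℝ → ℝ}, ContDiff ℝ ∞ ξ → ξ p = 0 → ∃ G : ℝ → ℝ, ContDiff ℝ ∞ G ∧
      ∀ᶠ x in 𝓝[≠] p, lieForm ξ θ x / θ x = G x := by
    intro ξ hξ hξp
    obtain ⟨M, hM, -, hρ⟩ := h.exists_residue p hp
    obtain ⟨η, hη, -, quotient⟩ := exists_hadamard_quotient hξ p
    have := contDiff_deriv hξ
    refine ⟨fun x => η x * M x + deriv ξ x, by fun_prop, ?_⟩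
    filter_upwards [hρ, h.eventually_notMem p, self_mem_nhdsWithin] with x hx hxP (hxp : x ≠ p)
    have hxp' : x - p ≠ 0 := sub_ne_zero.2 hxp
    rw [lieForm_div ξ (h.ne_zero x hxP), hx, quotient x, hξp]
    field_simp
    ring
  obtain ⟨G₁, hG₁, e₁⟩ := smooth_quotient h₁ hp₁
  obtain ⟨G₂, hG₂, e₂⟩ := smooth_quotient h₂ hp₂
  have := contDiff_deriv hG₂
  have hG : Continuous fun x => G₁ x * deriv G₂ x := by fun_prop
  refine ⟨_, ((hG.tendsto p).mono_left nhdsWithin_le_nhds).congr' ?_⟩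
  filter_upwards [e₁, eventually_eventually_nhdsWithin.2 e₂, self_mem_nhdsWithin]
    with x hx₁ hx₂ hxp
  rw [isOpen_compl_singleton.nhdsWithin_eq hxp] at hx₂
  rw [density, hx₁, EventuallyEq.deriv_eq hx₂]

theorem intervalIntegrable_density (h : IsRiccatiForm P q θ) (hq : Continuous q)
    (h₁ : ContDiff ℝ ∞ ξ₁) (h₂ : ContDiff ℝ ∞ ξ₂) {a b : ℝ}
    (hz : ∀ p ∈ Set.uIcc a b, p ∈ P → ξ₁ p = 0 ∧ ξ₂ p = 0) :
    IntervalIntegrable (density θ ξ₁ ξ₂) volume a b := by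
  have hcont := h.continuousOn_density hq h₁ h₂
  refine intervalIntegrable_of_tendsto_nhdsNE h.compl_mem_codiscrete hcont fun x hx => ?_
  by_cases hxP : x ∈ P
  · exact h.exists_tendsto_density h₁ h₂ hxP (hz x hx hxP).1 (hz x hx hxP).2
  · exact ⟨_, (hcont.continuousAt (h.compl_mem_nhds hxP)).tendsto.mono_left nhdsWithin_le_nhds⟩

end IsRiccatiForm

/-! ### The Schwarzian derivative of a real function -/

theorem contDiffAt_deriv_infty {f : ℝ → ℝ} {x : ℝ} (hf : ContDiffAt ℝ ∞ f x) :
    ContDiffAt ℝ ∞ (deriv f) x :=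
  contDiffAt_infty.2 fun n => contDiffAt_deriv (contDiffAt_infty.1 hf (n + 1))

theorem hasDerivAt_of_contDiffAt {f : ℝ → ℝ} {x : ℝ} (hf : ContDiffAt ℝ ∞ f x) :
    HasDerivAt f (deriv f x) x :=
  (hf.differentiableAt (by simp)).hasDerivAt

theorem contDiffAt_schwarzReal {f : ℝ → ℝ} {x : ℝ} (hf : ContDiffAt ℝ ∞ f x)
    (hd : deriv f x ≠ 0) : ContDiffAt ℝ ∞ (schwarzReal f) x := by
  have h₁ := contDiffAt_deriv_infty hf
  have h₂ := contDiffAt_deriv_infty h₁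
  have h₃ := contDiffAt_deriv_infty h₂
  exact (h₃.div h₁ hd).sub (contDiffAt_const.mul ((h₂.div h₁ hd).pow 2))

theorem schwarzReal_comp_add_const (f : ℝ → ℝ) (c x : ℝ) :
    schwarzReal (fun y => f (y + c)) x = schwarzReal f (x + c) := by
  have deriv_shift (f : ℝ → ℝ) : deriv (fun y => f (y + c)) = fun y => deriv f (y + c) :=
    funext fun y => deriv_comp_add_const f c y
  simp only [schwarzReal, deriv_shift]

theorem hasDerivAt_logDeriv_deriv {f : ℝ → ℝ} {x : ℝ} (hf : ContDiffAt ℝ ∞ f x)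
    (hd : deriv f x ≠ 0) :
    HasDerivAt (logDeriv (deriv f)) (schwarzReal f x + logDeriv (deriv f) x ^ 2 / 2) x := by
  have h₁ := contDiffAt_deriv_infty hf
  refine ((hasDerivAt_of_contDiffAt (contDiffAt_deriv_infty h₁)).div
    (hasDerivAt_of_contDiffAt h₁) hd).congr_deriv ?_
  simp only [schwarzReal, logDeriv_apply]
  field_simp
  ring

theorem logDeriv_deriv_inv {f : ℝ → ℝ} (hf : ContDiff ℝ ∞ f) {x : ℝ} (hx : f x ≠ 0)
    (hd : deriv f x ≠ 0) :
    logDeriv (deriv fun y => (f y)⁻¹) x = logDeriv (deriv f) x - 2 * logDeriv f x := by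
  have D₀ := hasDerivAt_of_contDiff hf
  have D₁ := hasDerivAt_of_contDiff (contDiff_deriv hf)
  have deriv_inv : deriv (fun y => (f y)⁻¹) =ᶠ[𝓝 x] fun y => -deriv f y / f y ^ 2 := by
    filter_upwards [hf.continuous.continuousAt.eventually_ne hx] with y hy
    exact ((D₀ y).inv hy).deriv
  have deriv_deriv_inv : HasDerivAt (fun y => -deriv f y / f y ^ 2) _ x :=
    (D₁ x).neg.div ((D₀ x).pow 2) (pow_ne_zero 2 hx)
  rw [logDeriv_apply, deriv_inv.deriv_eq, deriv_deriv_inv.deriv, deriv_inv.eq_of_nhds]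
  simp only [logDeriv_apply, Pi.neg_apply]
  field_simp
  ring

theorem exists_residue_logDeriv_deriv_inv {f : ℝ → ℝ} (hf : ContDiff ℝ ∞ f) {p : ℝ}
    (hp : f p = 0) (hd : deriv f p ≠ 0) :
    ∃ M : ℝ → ℝ, ContDiff ℝ ∞ M ∧ M p = -2 ∧
      ∀ᶠ x in 𝓝[≠] p, logDeriv (deriv fun y => (f y)⁻¹) x = M x / (x - p) := by
  obtain ⟨h, hh, hhp, quotient⟩ := exists_hadamard_quotient hf p
  simp only [hp, zero_add] at quotient
  have h₁ := contDiff_deriv hf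
  have h₂ := contDiff_deriv h₁
  have h_ne : ∀ᶠ x in 𝓝 p, h x ≠ 0 := hh.continuous.continuousAt.eventually_ne (hhp ▸ hd)
  have deriv_ne : ∀ᶠ x in 𝓝 p, deriv f x ≠ 0 := h₁.continuous.continuousAt.eventually_ne hd
  obtain ⟨M, hM, hMeq⟩ := exists_contDiff_eventuallyEq
    (f := fun x => (x - p) * deriv (deriv f) x / deriv f x - 2 * deriv f x / h x) (p := p) <| by
      filter_upwards [h_ne, deriv_ne] with x hx hx'
      exact (((contDiffAt_id.sub contDiffAt_const).mul h₂.contDiffAt).div h₁.contDiffAt hx').sub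
        ((contDiffAt_const.mul h₁.contDiffAt).div hh.contDiffAt hx)
  refine ⟨M, hM, ?_, ?_⟩
  · rw [hMeq.eq_of_nhds, hhp]
    field_simp
    ring
  · filter_upwards [self_mem_nhdsWithin, nhdsWithin_le_nhds (hMeq.and (h_ne.and deriv_ne))]
      with x (hxp : x ≠ p) ⟨hMx, hx, hx'⟩
    have hxp' : x - p ≠ 0 := sub_ne_zero.2 hxp
    rw [logDeriv_deriv_inv hf (quotient x ▸ mul_ne_zero hxp' hx) hx', hMx, logDeriv_apply,
      logDeriv_apply, quotient x]
    field_simp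

/-! ### Affine charts -/

theorem coe_coord {z : RP1} (hz : z ≠ OnePoint.infty) : ((coord z : ℝ) : RP1) = z := by
  obtain ⟨r, rfl⟩ := OnePoint.ne_infty_iff_exists.1 hz
  rfl

theorem smul_coe_ne_infty_iff (B : GL (Fin 2) ℝ) (r : ℝ) :
    B • (r : RP1) ≠ OnePoint.infty ↔ B 1 0 * r + B 1 1 ≠ 0 := by
  rw [OnePoint.smul_some_eq_ite]
  split_ifs with h <;> simp [h]

theorem coord_smul_coe (B : GL (Fin 2) ℝ) (r : ℝ) :
    coord (B • (r : RP1)) = (B 0 0 * r + B 0 1) / (B 1 0 * r + B 1 1) := by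
  rw [OnePoint.smul_some_eq_ite]
  split_ifs with h
  · rw [h, div_zero]
    rfl
  · rfl

theorem coord_invGL_smul (z : RP1) : coord (invGL • z) = (coord z)⁻¹ := by
  induction z using OnePoint.rec with
  | infty =>
    rw [OnePoint.smul_infty_eq_ite]
    simp [invGL, Matrix.GeneralLinearGroup.mkOfDetNeZero, coord]
  | coe r =>
    rw [coord_smul_coe]
    simp [invGL, Matrix.GeneralLinearGroup.mkOfDetNeZero, coord]

theorem invGL_smul_infty : invGL • (OnePoint.infty : RP1) = ((0 : ℝ) : RP1) := by
  rw [OnePoint.smul_infty_eq_ite]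
  simp [invGL, Matrix.GeneralLinearGroup.mkOfDetNeZero]

theorem contDiffAt_coord_smul {f : ℝ → ℝ} {x : ℝ} (hf : ContDiffAt ℝ ∞ f x) {B : GL (Fin 2) ℝ}
    (hB : B • ((f x : ℝ) : RP1) ≠ OnePoint.infty) :
    ContDiffAt ℝ ∞ (fun y => coord (B • ((f y : ℝ) : RP1))) x := by
  simp only [coord_smul_coe]
  exact ((contDiffAt_const.mul hf).add contDiffAt_const).div
    ((contDiffAt_const.mul hf).add contDiffAt_const) ((smul_coe_ne_infty_iff B _).1 hB)

theorem hasDerivAt_coord_smul {f : ℝ → ℝ} {f' x : ℝ} (hf : HasDerivAt f f' x) {B : GL (Fin 2) ℝ}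
    (hB : B • ((f x : ℝ) : RP1) ≠ OnePoint.infty) :
    HasDerivAt (fun y => coord (B • ((f y : ℝ) : RP1)))
      (B.1.det * f' / (B 1 0 * f x + B 1 1) ^ 2) x := by
  simp only [coord_smul_coe]
  refine (((hf.const_mul (B 0 0)).add_const (B 0 1)).div
    ((hf.const_mul (B 1 0)).add_const (B 1 1)) ((smul_coe_ne_infty_iff B _).1 hB)).congr_deriv ?_
  rw [Matrix.det_fin_two]
  ring

namespace IsImmersion

variable {φ : ℝ → RP1} {g : GL (Fin 2) ℝ} {x : ℝ}

theorem exists_smul_eventuallyEq (hφ : IsImmersion φ) (g : GL (Fin 2) ℝ) (x : ℝ) :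
    ∃ (B : GL (Fin 2) ℝ) (f : ℝ → ℝ), ContDiffAt ℝ ∞ f x ∧ deriv f x ≠ 0 ∧
      (fun y => g • φ y) =ᶠ[𝓝 x] fun y => B • ((f y : ℝ) : RP1) := by
  obtain ⟨h, f, hf, hd, hloc⟩ := hφ x
  refine ⟨g * h⁻¹, f, hf, hd, ?_⟩
  filter_upwards [hloc] with y hy
  rw [← hy, mul_smul, inv_smul_smul]

theorem exists_smul_ne_infty (hφ : IsImmersion φ) (x : ℝ) :
    ∃ g : GL (Fin 2) ℝ, g • φ x ≠ OnePoint.infty := by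
  obtain ⟨g, f, -, -, hloc⟩ := hφ x
  exact ⟨g, hloc.self_of_nhds ▸ OnePoint.coe_ne_infty _⟩

theorem eventually_smul_ne_infty (hφ : IsImmersion φ) (hg : g • φ x ≠ OnePoint.infty) :
    ∀ᶠ y in 𝓝 x, g • φ y ≠ OnePoint.infty := by
  obtain ⟨B, f, hf, -, hloc⟩ := hφ.exists_smul_eventuallyEq g x
  have hB := (smul_coe_ne_infty_iff B (f x)).1 (hloc.eq_of_nhds ▸ hg)
  have hcont : ContinuousAt (fun y => B 1 0 * f y + B 1 1) x :=
    (hf.continuousAt.const_mul _).add_const _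
  filter_upwards [hloc, hcont.eventually_ne hB] with y hy hy'
  exact hy ▸ (smul_coe_ne_infty_iff B (f y)).2 hy'

theorem contDiffAt_coord (hφ : IsImmersion φ) (hg : g • φ x ≠ OnePoint.infty) :
    ContDiffAt ℝ ∞ (fun y => coord (g • φ y)) x := by
  obtain ⟨B, f, hf, -, hloc⟩ := hφ.exists_smul_eventuallyEq g x
  exact (contDiffAt_coord_smul hf (hloc.eq_of_nhds ▸ hg)).congr_of_eventuallyEq
    (hloc.fun_comp coord)

theorem deriv_coord_ne_zero (hφ : IsImmersion φ) (hg : g • φ x ≠ OnePoint.infty) :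
    deriv (fun y => coord (g • φ y)) x ≠ 0 := by
  obtain ⟨B, f, hf, hd, hloc⟩ := hφ.exists_smul_eventuallyEq g x
  have hB : B • ((f x : ℝ) : RP1) ≠ OnePoint.infty := hloc.eq_of_nhds ▸ hg
  have hderiv := (hasDerivAt_coord_smul (hasDerivAt_of_contDiffAt hf) hB).deriv
  have hcoord : (fun y => coord (g • φ y)) =ᶠ[𝓝 x] fun y => coord (B • ((f y : ℝ) : RP1)) :=
    hloc.fun_comp coord
  rw [hcoord.deriv_eq]
  exact hderiv ▸ div_ne_zero (mul_ne_zero B.det_ne_zero hd)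
    (pow_ne_zero 2 ((smul_coe_ne_infty_iff B _).1 hB))

theorem schwarz_eq_schwarzReal (hφ : IsImmersion φ) (hg : g • φ x ≠ OnePoint.infty) :
    schwarz φ x = schwarzReal (fun y => coord (g • φ y)) x := by
  refine schwarz_eq_local (hφ.contDiffAt_coord hg) (hφ.deriv_coord_ne_zero hg) g ?_
  filter_upwards [hφ.eventually_smul_ne_infty hg] with y hy using (coe_coord hy).symm

theorem contDiff_schwarz (hφ : IsImmersion φ) : ContDiff ℝ ∞ (schwarz φ) := by
  refine contDiff_iff_contDiffAt.2 fun x => ?_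
  obtain ⟨g, hg⟩ := hφ.exists_smul_ne_infty x
  refine (contDiffAt_schwarzReal (hφ.contDiffAt_coord hg)
    (hφ.deriv_coord_ne_zero hg)).congr_of_eventuallyEq ?_
  filter_upwards [hφ.eventually_smul_ne_infty hg] with y hy using hφ.schwarz_eq_schwarzReal hy

end IsImmersion

theorem schwarz_comp_add_const (φ : ℝ → RP1) (c x : ℝ) :
    schwarz (fun y => φ (y + c)) x = schwarz φ (x + c) := by
  unfold schwarz
  rw [← schwarzReal_comp_add_const, ← schwarzReal_comp_add_const]

theorem DevMap.periodic_schwarz (φ : DevMap) :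
    Function.Periodic (schwarz φ.toFun) (2 * Real.pi) := by
  intro x
  obtain ⟨T, hT⟩ := φ.equivariant
  rw [← schwarz_comp_add_const, ← schwarz_smul φ.immersion T, funext hT]

section Poles

variable {g : GL (Fin 2) ℝ} {φ : DevMap} {x p : ℝ}

theorem pullForm_ne_zero (hx : x ∉ poles g φ) : pullForm g φ x ≠ 0 :=
  φ.immersion.deriv_coord_ne_zero hx

theorem invGL_mul_smul_of_mem_poles (hp : p ∈ poles g φ) :
    (invGL * g) • φ.toFun p = ((0 : ℝ) : RP1) := by
  rw [mul_smul, show g • φ.toFun p = OnePoint.infty from hp, invGL_smul_infty]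

theorem invGL_mul_smul_ne_infty (hp : p ∈ poles g φ) :
    (invGL * g) • φ.toFun p ≠ OnePoint.infty :=
  invGL_mul_smul_of_mem_poles hp ▸ OnePoint.coe_ne_infty _

theorem eventually_notMem_poles (g : GL (Fin 2) ℝ) (φ : DevMap) (x : ℝ) :
    ∀ᶠ y in 𝓝[≠] x, y ∉ poles g φ := by
  by_cases hx : x ∈ poles g φ
  · have hinv := invGL_mul_smul_ne_infty hx
    filter_upwards [(hasDerivAt_of_contDiffAt (φ.immersion.contDiffAt_coord hinv)).eventually_ne
      (φ.immersion.deriv_coord_ne_zero hinv) (c := 0)] with y hy hmem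
    exact hy (by rw [invGL_mul_smul_of_mem_poles hmem]; rfl)
  · exact nhdsWithin_le_nhds (φ.immersion.eventually_smul_ne_infty hx)

theorem compl_poles_mem_codiscrete (g : GL (Fin 2) ℝ) (φ : DevMap) :
    (poles g φ)ᶜ ∈ codiscrete ℝ :=
  mem_codiscrete.2 fun x => disjoint_principal_right.2 <| by
    rw [compl_compl]
    exact eventually_notMem_poles g φ x

theorem exists_residue_logDeriv_pullForm (hp : p ∈ poles g φ) :
    ∃ M : ℝ → ℝ, ContDiff ℝ ∞ M ∧ M p = -2 ∧
      ∀ᶠ x in 𝓝[≠] p, logDeriv (pullForm g φ) x = M x / (x - p) := by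
  have hinv := invGL_mul_smul_ne_infty hp
  obtain ⟨S, hS, hSeq⟩ := exists_contDiff_eventuallyEq
    ((φ.immersion.eventually_smul_ne_infty hinv).mono fun y => φ.immersion.contDiffAt_coord)
  have hSp : S p = 0 := by
    rw [hSeq.eq_of_nhds, invGL_mul_smul_of_mem_poles hp]
    rfl
  obtain ⟨M, hM, hMp, hMS⟩ := exists_residue_logDeriv_deriv_inv hS hSp
    (hSeq.deriv_eq ▸ φ.immersion.deriv_coord_ne_zero hinv)
  have hcoord : (fun y => coord (g • φ.toFun y)) =ᶠ[𝓝 p] fun y => (S y)⁻¹ := by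
    filter_upwards [hSeq] with y hy
    rw [hy, mul_smul, coord_invGL_smul, inv_inv]
  have hpull : pullForm g φ =ᶠ[𝓝 p] deriv fun y => (S y)⁻¹ := hcoord.deriv
  refine ⟨M, hM, hMp, ?_⟩
  filter_upwards [hMS, nhdsWithin_le_nhds hpull.eventually_nhds] with x hx hx'
  rw [← hx, logDeriv_apply, logDeriv_apply, EventuallyEq.deriv_eq hx', hx'.self_of_nhds]

theorem isRiccatiForm_pullForm (g : GL (Fin 2) ℝ) (φ : DevMap) :
    IsRiccatiForm (poles g φ) (schwarz φ.toFun) (pullForm g φ) where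
  compl_mem_codiscrete := compl_poles_mem_codiscrete g φ
  ne_zero _ hx := pullForm_ne_zero hx
  hasDerivAt_logDeriv x hx := by
    rw [φ.immersion.schwarz_eq_schwarzReal hx]
    exact hasDerivAt_logDeriv_deriv (φ.immersion.contDiffAt_coord hx)
      (φ.immersion.deriv_coord_ne_zero hx)
  exists_residue _ hp := exists_residue_logDeriv_pullForm hp

end Poles

/-! ### Functions on the circle -/

theorem periodic_deriv {f : ℝ → ℝ} {c : ℝ} (hf : Function.Periodic f c) :
    Function.Periodic (deriv f) c := by
  intro x
  rw [← deriv_comp_add_const, funext hf]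

theorem deriv_mem_Vect {f : ℝ → ℝ} (hf : f ∈ Vect) : deriv f ∈ Vect :=
  ⟨contDiff_deriv hf.1, periodic_deriv hf.2⟩

theorem mul_mem_Vect {f g : ℝ → ℝ} (hf : f ∈ Vect) (hg : g ∈ Vect) : f * g ∈ Vect :=
  ⟨hf.1.mul hg.1, hf.2.mul hg.2⟩

theorem continuous_of_mem_Vect {f : ℝ → ℝ} (hf : f ∈ Vect) : Continuous f :=
  hf.1.continuous

theorem fieldBracket_mem_Vect {ξ η : ℝ → ℝ} (hξ : ξ ∈ Vect) (hη : η ∈ Vect) :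
    fieldBracket ξ η ∈ Vect :=
  Vect.sub_mem (mul_mem_Vect hξ (deriv_mem_Vect hη)) (mul_mem_Vect (deriv_mem_Vect hξ) hη)

theorem baseDensity_mem_Vect {q ξ η : ℝ → ℝ} (hq : q ∈ Vect) (hξ : ξ ∈ Vect) (hη : η ∈ Vect) :
    baseDensity q ξ η ∈ Vect :=
  Vect.add_mem (Vect.neg_mem (mul_mem_Vect hq (fieldBracket_mem_Vect hξ hη)))
    (mul_mem_Vect (deriv_mem_Vect hξ) (deriv_mem_Vect (deriv_mem_Vect hη)))

/-- The integral over the circle of the product of a quadratic differential `m dx²` and a vector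
field `ξ d/dx`. -/
def pairing (m ξ : ℝ → ℝ) : ℝ := ∫ x in (0 : ℝ)..(2 * Real.pi), m x * ξ x

section Pairing

variable {m m' ξ ξ' : ℝ → ℝ}

theorem intervalIntegrable_of_mem_Vect (hm : m ∈ Vect) (a b : ℝ) :
    IntervalIntegrable m volume a b :=
  (continuous_of_mem_Vect hm).intervalIntegrable a b

theorem pairing_add_left (hm : m ∈ Vect) (hm' : m' ∈ Vect) (hξ : ξ ∈ Vect) :
    pairing (m + m') ξ = pairing m ξ + pairing m' ξ := by
  simp only [pairing, Pi.add_apply, add_mul]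
  exact intervalIntegral.integral_add (intervalIntegrable_of_mem_Vect (mul_mem_Vect hm hξ) _ _)
    (intervalIntegrable_of_mem_Vect (mul_mem_Vect hm' hξ) _ _)

theorem pairing_smul_left (c : ℝ) (m ξ : ℝ → ℝ) : pairing (c • m) ξ = c * pairing m ξ := by
  simp only [pairing, Pi.smul_apply, smul_eq_mul, mul_assoc, intervalIntegral.integral_const_mul]

theorem pairing_comm (m ξ : ℝ → ℝ) : pairing m ξ = pairing ξ m := by
  simp only [pairing, mul_comm]

theorem pairing_add_right (hm : m ∈ Vect) (hξ : ξ ∈ Vect) (hξ' : ξ' ∈ Vect) :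
    pairing m (ξ + ξ') = pairing m ξ + pairing m ξ' := by
  rw [pairing_comm, pairing_add_left hξ hξ' hm, pairing_comm ξ, pairing_comm ξ']

theorem pairing_smul_right (c : ℝ) (m ξ : ℝ → ℝ) : pairing m (c • ξ) = c * pairing m ξ := by
  rw [pairing_comm, pairing_smul_left, pairing_comm ξ]

theorem eq_zero_of_pairing_self_eq_zero (hm : m ∈ Vect) (h : pairing m m = 0) : m = 0 := by
  have hc := continuous_of_mem_Vect hm
  have eq_zero : ∀ x ∈ Set.Icc 0 (2 * Real.pi), m x = 0 := by
    by_contra! ⟨x, hx, hne⟩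
    exact (intervalIntegral.integral_pos Real.two_pi_pos (hc.mul hc).continuousOn
      (fun x _ => mul_self_nonneg (m x)) ⟨x, hx, mul_self_pos.2 hne⟩).ne' h
  funext x
  obtain ⟨y, hy, hxy⟩ := hm.2.exists_mem_Ico₀ Real.two_pi_pos x
  exact hxy.trans (eq_zero y (Set.Ico_subset_Icc_self hy))

theorem integral_deriv_eq_zero {Z : ℝ → ℝ} (hZ : Z ∈ Vect) :
    ∫ x in (0 : ℝ)..(2 * Real.pi), deriv Z x = 0 := by
  rw [intervalIntegral.integral_deriv_eq_sub (fun x _ => hZ.1.differentiable (by simp) x)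
    (intervalIntegrable_of_mem_Vect (deriv_mem_Vect hZ) _ _), sub_eq_zero]
  simpa only [zero_add] using hZ.2 0

theorem integral_eq_of_sub_eq_deriv {f g Z : ℝ → ℝ} (hf : f ∈ Vect) (hg : g ∈ Vect)
    (hZ : Z ∈ Vect) (h : ∀ x, f x - g x = deriv Z x) :
    ∫ x in (0 : ℝ)..(2 * Real.pi), f x = ∫ x in (0 : ℝ)..(2 * Real.pi), g x := by
  rw [← sub_eq_zero, ← intervalIntegral.integral_sub (intervalIntegrable_of_mem_Vect hf _ _)
    (intervalIntegrable_of_mem_Vect hg _ _), funext h, integral_deriv_eq_zero hZ]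

end Pairing

/-! ### The infinitesimal action of vector fields -/

/-- The Lie derivative along `ξ d/dx` of the quadratic differential `m dx²`. -/
def quadLie (ξ m : ℝ → ℝ) (x : ℝ) : ℝ := ξ x * deriv m x + 2 * deriv ξ x * m x

/-- The infinitesimal variation along `ξ d/dx` of a projective structure with Schwarzian
derivative `q`: the Lie derivative of a quadratic differential, plus the Gelfand-Fuchs cocycle. -/
def schwarzLie (q ξ : ℝ → ℝ) (x : ℝ) : ℝ := quadLie ξ q x + deriv (deriv (deriv ξ)) x

section InfinitesimalAction

variable {q m ξ η : ℝ → ℝ}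

theorem quadLie_mem_Vect (hξ : ξ ∈ Vect) (hm : m ∈ Vect) : quadLie ξ m ∈ Vect :=
  Vect.add_mem (mul_mem_Vect hξ (deriv_mem_Vect hm))
    (mul_mem_Vect (Vect.smul_mem 2 (deriv_mem_Vect hξ)) hm)

theorem schwarzLie_mem_Vect (hq : q ∈ Vect) (hξ : ξ ∈ Vect) : schwarzLie q ξ ∈ Vect :=
  Vect.add_mem (quadLie_mem_Vect hξ hq)
    (deriv_mem_Vect (deriv_mem_Vect (deriv_mem_Vect hξ)))

theorem pairing_quadLie (hm : m ∈ Vect) (hξ : ξ ∈ Vect) (hη : η ∈ Vect) :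
    pairing (quadLie ξ m) η = pairing m (fieldBracket η ξ) := by
  have dm := hasDerivAt_of_contDiff hm.1
  have dξ := hasDerivAt_of_contDiff hξ.1
  have dη := hasDerivAt_of_contDiff hη.1
  refine integral_eq_of_sub_eq_deriv (mul_mem_Vect (quadLie_mem_Vect hξ hm) hη)
    (mul_mem_Vect hm (fieldBracket_mem_Vect hη hξ)) (mul_mem_Vect (mul_mem_Vect hξ hm) hη)
    fun x => ?_
  rw [(((dξ x).mul (dm x)).mul (dη x)).deriv]
  simp only [quadLie, fieldBracket, Pi.mul_apply]
  ring

theorem pairing_schwarzLie (hq : q ∈ Vect) (hξ : ξ ∈ Vect) (hη : η ∈ Vect) :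
    pairing (schwarzLie q ξ) η = ∫ x in (0 : ℝ)..(2 * Real.pi), baseDensity q ξ η x := by
  have hξ₁ := deriv_mem_Vect hξ
  have hξ₂ := deriv_mem_Vect hξ₁
  have hη₁ := deriv_mem_Vect hη
  have dq := hasDerivAt_of_contDiff hq.1
  have dξ := hasDerivAt_of_contDiff hξ.1
  have dξ₁ := hasDerivAt_of_contDiff hξ₁.1
  have dξ₂ := hasDerivAt_of_contDiff hξ₂.1
  have dη := hasDerivAt_of_contDiff hη.1
  have dη₁ := hasDerivAt_of_contDiff hη₁.1
  refine integral_eq_of_sub_eq_deriv (mul_mem_Vect (schwarzLie_mem_Vect hq hξ) hη)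
    (baseDensity_mem_Vect hq hξ hη) (Z := q * ξ * η + deriv (deriv ξ) * η - deriv ξ * deriv η)
    (Vect.sub_mem (Vect.add_mem (mul_mem_Vect (mul_mem_Vect hq hξ) hη) (mul_mem_Vect hξ₂ hη))
      (mul_mem_Vect hξ₁ hη₁)) fun x => ?_
  rw [(((((dq x).mul (dξ x)).mul (dη x)).add ((dξ₂ x).mul (dη x))).sub
    ((dξ₁ x).mul (dη₁ x))).deriv]
  simp only [schwarzLie, quadLie, baseDensity, fieldBracket, Pi.mul_apply]
  ring

theorem integral_baseDensity_swap (hq : q ∈ Vect) (hξ : ξ ∈ Vect) (hη : η ∈ Vect) :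
    ∫ x in (0 : ℝ)..(2 * Real.pi), baseDensity q ξ η x =
      -∫ x in (0 : ℝ)..(2 * Real.pi), baseDensity q η ξ x := by
  have hξ₁ := deriv_mem_Vect hξ
  have hη₁ := deriv_mem_Vect hη
  rw [← intervalIntegral.integral_neg]
  refine integral_eq_of_sub_eq_deriv (baseDensity_mem_Vect hq hξ hη)
    (Vect.neg_mem (baseDensity_mem_Vect hq hη hξ)) (mul_mem_Vect hξ₁ hη₁) fun x => ?_
  rw [((hasDerivAt_of_contDiff hξ₁.1 x).mul (hasDerivAt_of_contDiff hη₁.1 x)).deriv]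
  simp only [baseDensity, fieldBracket]
  ring

theorem pairing_schwarzLie_swap (hq : q ∈ Vect) (hξ : ξ ∈ Vect) (hη : η ∈ Vect) :
    pairing (schwarzLie q ξ) η = -pairing (schwarzLie q η) ξ := by
  rw [pairing_schwarzLie hq hξ hη, pairing_schwarzLie hq hη hξ, integral_baseDensity_swap hq hξ hη]

/-- The Wronskian determinant of the vector fields `ξ d/dx`, `η d/dx` and `ζ d/dx`. -/
def wronskian (ξ η ζ : ℝ → ℝ) : ℝ → ℝ :=
  deriv (deriv ξ) * fieldBracket η ζ + deriv (deriv η) * fieldBracket ζ ξ +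
    deriv (deriv ζ) * fieldBracket ξ η

variable {ζ : ℝ → ℝ}

theorem wronskian_mem_Vect (hξ : ξ ∈ Vect) (hη : η ∈ Vect) (hζ : ζ ∈ Vect) :
    wronskian ξ η ζ ∈ Vect := by
  have minor_mem {u v w : ℝ → ℝ} (hu : u ∈ Vect) (hv : v ∈ Vect) (hw : w ∈ Vect) :=
    mul_mem_Vect (deriv_mem_Vect (deriv_mem_Vect hu)) (fieldBracket_mem_Vect hv hw)
  exact Vect.add_mem (Vect.add_mem (minor_mem hξ hη hζ) (minor_mem hη hζ hξ)) (minor_mem hζ hξ hη)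

/-- The coefficients of `q` and `q'` on the right are determinants with two equal columns. -/
theorem deriv_wronskian (q : ℝ → ℝ) (hξ : ContDiff ℝ ∞ ξ) (hη : ContDiff ℝ ∞ η)
    (hζ : ContDiff ℝ ∞ ζ) :
    deriv (wronskian ξ η ζ) = schwarzLie q ξ * fieldBracket η ζ +
      schwarzLie q η * fieldBracket ζ ξ + schwarzLie q ζ * fieldBracket ξ η := by
  have d₀ {u : ℝ → ℝ} (hu : ContDiff ℝ ∞ u) := hasDerivAt_of_contDiff hu
  have d₁ {u : ℝ → ℝ} (hu : ContDiff ℝ ∞ u) := d₀ (contDiff_deriv hu)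
  have d₂ {u : ℝ → ℝ} (hu : ContDiff ℝ ∞ u) := d₁ (contDiff_deriv hu)
  funext x
  have minor {u v w : ℝ → ℝ} (hu : ContDiff ℝ ∞ u) (hv : ContDiff ℝ ∞ v) (hw : ContDiff ℝ ∞ w) :
      HasDerivAt (deriv (deriv u) * fieldBracket v w)
        (deriv (deriv (deriv u)) x * fieldBracket v w x +
          deriv (deriv u) x * (v x * deriv (deriv w) x - deriv (deriv v) x * w x)) x := by
    refine ((d₂ hu x).mul (((d₀ hv x).mul (d₁ hw x)).sub
      ((d₁ hv x).mul (d₀ hw x)))).congr_deriv ?_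
    simp only [fieldBracket, Pi.mul_apply, Pi.sub_apply]
    ring
  rw [wronskian, (((minor hξ hη hζ).add (minor hη hζ hξ)).add (minor hζ hξ hη)).deriv]
  simp only [schwarzLie, quadLie, fieldBracket, Pi.mul_apply, Pi.add_apply]
  ring

theorem pairing_schwarzLie_cocycle (hq : q ∈ Vect) (hξ : ξ ∈ Vect) (hη : η ∈ Vect)
    (hζ : ζ ∈ Vect) :
    pairing (schwarzLie q ξ) (fieldBracket η ζ) + pairing (schwarzLie q η) (fieldBracket ζ ξ) +
      pairing (schwarzLie q ζ) (fieldBracket ξ η) = 0 := by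
  have integrable {u v w : ℝ → ℝ} (hu : u ∈ Vect) (hv : v ∈ Vect) (hw : w ∈ Vect) :=
    intervalIntegrable_of_mem_Vect
      (mul_mem_Vect (schwarzLie_mem_Vect hq hu) (fieldBracket_mem_Vect hv hw)) 0 (2 * Real.pi)
  rw [← integral_deriv_eq_zero (wronskian_mem_Vect hξ hη hζ), deriv_wronskian q hξ.1 hη.1 hζ.1]
  have h₁ := intervalIntegral.integral_add (integrable hξ hη hζ) (integrable hη hζ hξ)
  have h₂ := intervalIntegral.integral_add
    ((integrable hξ hη hζ).add (integrable hη hζ hξ)) (integrable hζ hξ hη)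
  exact (h₂.trans (congrArg (· + _) h₁)).symm

end InfinitesimalAction

/-! ### The symplectic form -/

namespace ProjStr

variable (α : ProjStr)

theorem schwarzian_mem_Vect : α.schwarzian ∈ Vect := by
  induction α using Quotient.inductionOn with
  | h φ => exact ⟨φ.immersion.contDiff_schwarz, φ.periodic_schwarz⟩

theorem coe_vel (ξ : Vect) : (α.vel ξ : ℝ → ℝ) = schwarzLie α.schwarzian ξ := rfl

theorem exists_vel_eq (δ : α.Tangent) : ∃ ξ : Vect, α.vel ξ = δ :=
  LinearMap.surjective_rangeRestrict _ δ

theorem coe_tangent_mem_Vect {α : ProjStr} (δ : α.Tangent) : (δ : ℝ → ℝ) ∈ Vect := by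
  obtain ⟨ξ, rfl⟩ := α.exists_vel_eq δ
  exact schwarzLie_mem_Vect α.schwarzian_mem_Vect ξ.2

/-- A vector field that represents a tangent vector, chosen linearly. -/
def field : α.Tangent →ₗ[ℝ] Vect :=
  (α.lie.rangeRestrict.exists_rightInverse_of_surjective α.lie.range_rangeRestrict).choose

theorem vel_field (δ : α.Tangent) : α.vel (α.field δ) = δ :=
  LinearMap.congr_fun
    (α.lie.rangeRestrict.exists_rightInverse_of_surjective α.lie.range_rangeRestrict).choose_spec δ

/-- The symplectic form on the tangent space: the pairing of the first tangent vector with a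
vector field that represents the second one. -/
def form : LinearMap.BilinForm ℝ α.Tangent :=
  LinearMap.mk₂ ℝ (fun δ₁ δ₂ => pairing δ₁ (α.field δ₂))
    (fun δ δ' ε =>
      pairing_add_left (coe_tangent_mem_Vect δ) (coe_tangent_mem_Vect δ') (α.field ε).2)
    (fun c δ ε => pairing_smul_left c δ (α.field ε))
    (fun δ ε ε' => by
      rw [map_add]
      exact pairing_add_right (coe_tangent_mem_Vect δ) (α.field ε).2 (α.field ε').2)
    (fun c δ ε => by
      rw [map_smul]
      exact pairing_smul_right c δ (α.field ε))

/-- By antisymmetry the pairing with `η` depends only on the tangent vector represented by `η`. -/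
theorem form_vel (ξ η : Vect) :
    α.form (α.vel ξ) (α.vel η) = pairing (schwarzLie α.schwarzian ξ) η := by
  have hq := α.schwarzian_mem_Vect
  have hfield : schwarzLie α.schwarzian (α.field (α.vel η)) = schwarzLie α.schwarzian η :=
    congrArg Subtype.val (α.vel_field (α.vel η))
  calc α.form (α.vel ξ) (α.vel η)
      = pairing (schwarzLie α.schwarzian ξ) (α.field (α.vel η)) := rfl
    _ = -pairing (schwarzLie α.schwarzian η) ξ := by
      rw [pairing_schwarzLie_swap hq ξ.2 (α.field (α.vel η)).2, hfield]
    _ = pairing (schwarzLie α.schwarzian ξ) η := (pairing_schwarzLie_swap hq ξ.2 η.2).symm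

theorem form_vel_eq_integral (ξ η : Vect) (x₀ : ℝ) :
    α.form (α.vel ξ) (α.vel η) =
      ∫ x in x₀..(x₀ + 2 * Real.pi), baseDensity α.schwarzian ξ η x := by
  have hq := α.schwarzian_mem_Vect
  rw [α.form_vel, pairing_schwarzLie hq ξ.2 η.2,
    (baseDensity_mem_Vect hq ξ.2 η.2).2.intervalIntegral_add_eq x₀ 0, zero_add]

theorem form_isAlt : α.form.IsAlt := by
  intro δ
  obtain ⟨ξ, rfl⟩ := α.exists_vel_eq δ
  rw [α.form_vel]
  exact self_eq_neg.1 (pairing_schwarzLie_swap α.schwarzian_mem_Vect ξ.2 ξ.2)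

theorem form_nondegenerate : α.form.Nondegenerate := by
  have separatingLeft : α.form.SeparatingLeft := by
    intro δ h
    have hδ := coe_tangent_mem_Vect δ
    refine Subtype.ext (eq_zero_of_pairing_self_eq_zero hδ ?_)
    obtain ⟨ξ, rfl⟩ := α.exists_vel_eq δ
    rw [α.coe_vel, ← h (α.vel ⟨_, hδ⟩), α.form_vel, α.coe_vel]
  exact ⟨separatingLeft, fun δ h => separatingLeft δ fun ε => by
    rw [← α.form_isAlt.neg_eq, h ε, neg_zero]⟩

theorem form_vel_eq_schwarz {α : ProjStr} {φ : DevMap} (hφ : φ.struct = α) (ξ₁ ξ₂ : Vect) :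
    α.form (α.vel ξ₁) (α.vel ξ₂) =
      -(∫ x in (0 : ℝ)..(2 * Real.pi), schwarz φ.toFun x *
          (ξ₁.1 x * deriv ξ₂.1 x - deriv ξ₁.1 x * ξ₂.1 x)) +
        ∫ x in (0 : ℝ)..(2 * Real.pi), deriv ξ₁.1 x * deriv (deriv ξ₂.1) x := by
  subst hφ
  have hint := (intervalIntegrable_of_mem_Vect (mul_mem_Vect φ.struct.schwarzian_mem_Vect
    (fieldBracket_mem_Vect ξ₁.2 ξ₂.2)) 0 (2 * Real.pi)).neg
  have hint' := intervalIntegrable_of_mem_Vect (mul_mem_Vect (deriv_mem_Vect ξ₁.2)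
    (deriv_mem_Vect (deriv_mem_Vect ξ₂.2))) 0 (2 * Real.pi)
  rw [form_vel_eq_integral _ ξ₁ ξ₂ 0, zero_add, ← intervalIntegral.integral_neg]
  exact intervalIntegral.integral_add hint hint'

section FinitePart

variable {α : ProjStr} {φ : DevMap} (hφ : φ.struct = α) (g : GL (Fin 2) ℝ) {x₀ : ℝ} {ξ₁ ξ₂ : Vect}
  (h₁ : ξ₁.1 x₀ = 0) (h₂ : ξ₂.1 x₀ = 0)
include hφ h₁ h₂

theorem hasFinitePart_form :
    HasFinitePart (poles g φ) (density (pullForm g φ) ξ₁.1 ξ₂.1) x₀ (x₀ + 2 * Real.pi)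
      (α.form (α.vel ξ₁) (α.vel ξ₂)) := by
  subst hφ
  rw [form_vel_eq_integral _ ξ₁ ξ₂ x₀]
  exact (isRiccatiForm_pullForm g φ).hasFinitePart_density
    (continuous_of_mem_Vect φ.struct.schwarzian_mem_Vect) ξ₁.2.1 ξ₂.2.1
    (le_add_of_nonneg_right Real.two_pi_pos.le) h₁ h₂ ((ξ₁.2.2 x₀).trans h₁) ((ξ₂.2.2 x₀).trans h₂)

theorem intervalIntegrable_density_and_integral_eq_form
    (hfin : ∀ x ∈ Set.Ioo x₀ (x₀ + 2 * Real.pi), g • φ.toFun x ≠ OnePoint.infty) :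
    IntervalIntegrable (density (pullForm g φ) ξ₁.1 ξ₂.1) volume x₀ (x₀ + 2 * Real.pi) ∧
      ∫ x in x₀..(x₀ + 2 * Real.pi), density (pullForm g φ) ξ₁.1 ξ₂.1 x =
        α.form (α.vel ξ₁) (α.vel ξ₂) := by
  have hle : x₀ ≤ x₀ + 2 * Real.pi := le_add_of_nonneg_right Real.two_pi_pos.le
  have hriccati := isRiccatiForm_pullForm g φ
  have hint : IntervalIntegrable (density (pullForm g φ) ξ₁.1 ξ₂.1) volume x₀
      (x₀ + 2 * Real.pi) := by
    refine hriccati.intervalIntegrable_density φ.immersion.contDiff_schwarz.continuous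
      ξ₁.2.1 ξ₂.2.1 fun p hp hpole => ?_
    rw [Set.uIcc_of_le hle] at hp
    obtain rfl | hp₀ := hp.1.eq_or_lt
    · exact ⟨h₁, h₂⟩
    obtain rfl | hp₁ := hp.2.eq_or_lt
    · exact ⟨(ξ₁.2.2 x₀).trans h₁, (ξ₂.2.2 x₀).trans h₂⟩
    exact absurd hpole (hfin p ⟨hp₀, hp₁⟩)
  refine ⟨hint, HasFinitePart.unique ?_ (hasFinitePart_form hφ g h₁ h₂)⟩
  exact (hasFinitePart_iff_interval hle).2
    (hasIntervalFinitePart_of_intervalIntegrable hriccati.compl_mem_codiscrete hint)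

end FinitePart

end ProjStr

theorem isGivenByIntegral_form (T : GL (Fin 2) ℝ) :
    IsGivenByIntegral (T := T) fun α δ₁ δ₂ => α.1.form δ₁ δ₂ :=
  fun _ _ hφ g _ _ _ h₁ h₂ => ProjStr.hasFinitePart_form hφ g h₁ h₂

/-! ### Infinitesimal automorphisms -/

/-- The coefficient at `t` of the vector field that the matrix `X` generates on the projective line
by the infinitesimal action of homographies. -/
def quadField (X : Matrix (Fin 2) (Fin 2) ℝ) (t : ℝ) : ℝ :=
  X 0 0 * t + X 0 1 - t * (X 1 0 * t + X 1 1)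

/-- The pull-back by `f` of the vector field that `X` generates on the projective line. -/
def pullQuadField (X : Matrix (Fin 2) (Fin 2) ℝ) (f : ℝ → ℝ) (x : ℝ) : ℝ :=
  quadField X (f x) / deriv f x

section RealPullback

variable {X Y : Matrix (Fin 2) (Fin 2) ℝ} {f : ℝ → ℝ} {x : ℝ}

theorem quadField_div_mul_sq (X : Matrix (Fin 2) (Fin 2) ℝ) (u : ℝ) {v : ℝ} (hv : v ≠ 0) :
    quadField X (u / v) * v ^ 2 = (X 0 0 * u + X 0 1 * v) * v - u * (X 1 0 * u + X 1 1 * v) := by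
  unfold quadField
  field_simp

theorem quadField_coord_smul {B : GL (Fin 2) ℝ} (h : Y * B.1 = B.1 * X) {t : ℝ}
    (ht : B • ((t : ℝ) : RP1) ≠ OnePoint.infty) :
    quadField Y (coord (B • ((t : ℝ) : RP1))) * (B 1 0 * t + B 1 1) ^ 2 =
      B.1.det * quadField X t := by
  have entry (i j : Fin 2) := congrFun (congrFun h i) j
  simp only [Matrix.mul_apply, Fin.sum_univ_two] at entry
  rw [coord_smul_coe, quadField_div_mul_sq _ _ ((smul_coe_ne_infty_iff B t).1 ht),
    Matrix.det_fin_two]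
  unfold quadField
  linear_combination (B 1 0 * t + B 1 1) * (t * entry 0 0 + entry 0 1) -
    (B 0 0 * t + B 0 1) * (t * entry 1 0 + entry 1 1)

theorem pullQuadField_coord_smul {B : GL (Fin 2) ℝ} (h : Y * B.1 = B.1 * X)
    (hf : DifferentiableAt ℝ f x) (hB : B • ((f x : ℝ) : RP1) ≠ OnePoint.infty) :
    pullQuadField Y (fun y => coord (B • ((f y : ℝ) : RP1))) x = pullQuadField X f x := by
  have hdet : B.1.det ≠ 0 := B.det_ne_zero
  unfold pullQuadField
  rw [(hasDerivAt_coord_smul hf.hasDerivAt hB).deriv, div_div_eq_mul_div,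
    quadField_coord_smul h hB, mul_div_mul_left _ _ hdet]

theorem pullQuadField_congr {h : ℝ → ℝ} (hfh : f =ᶠ[𝓝 x] h) :
    pullQuadField X f x = pullQuadField X h x := by
  rw [pullQuadField, pullQuadField, hfh.eq_of_nhds, hfh.deriv_eq]

theorem contDiffAt_pullQuadField (hf : ContDiffAt ℝ ∞ f x) (hd : deriv f x ≠ 0) :
    ContDiffAt ℝ ∞ (pullQuadField X f) x := by
  refine ContDiffAt.div ?_ (contDiffAt_deriv_infty hf) hd
  unfold quadField
  fun_prop

theorem hasDerivAt_quadField (X : Matrix (Fin 2) (Fin 2) ℝ) {f' : ℝ} (hf : HasDerivAt f f' x) :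
    HasDerivAt (fun y => quadField X (f y)) ((X 0 0 - X 1 1 - 2 * X 1 0 * f x) * f') x := by
  refine (((hf.const_mul (X 0 0)).add_const (X 0 1)).sub
    (hf.mul ((hf.const_mul (X 1 0)).add_const (X 1 1)))).congr_deriv ?_
  ring

theorem hasDerivAt_pullQuadField (hf : ContDiffAt ℝ ∞ f x) (hd : deriv f x ≠ 0) :
    HasDerivAt (pullQuadField X f)
      (X 0 0 - X 1 1 - 2 * X 1 0 * f x - logDeriv (deriv f) x * pullQuadField X f x) x := by
  refine ((hasDerivAt_quadField X (hasDerivAt_of_contDiffAt hf)).div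
    (hasDerivAt_of_contDiffAt (contDiffAt_deriv_infty hf)) hd).congr_deriv ?_
  rw [pullQuadField, logDeriv_apply]
  field_simp

theorem hasDerivAt_deriv_pullQuadField
    (hf : ∀ᶠ y in 𝓝 x, ContDiffAt ℝ ∞ f y ∧ deriv f y ≠ 0) :
    HasDerivAt (deriv (pullQuadField X f))
      (-(2 * X 1 0 * deriv f x) - logDeriv (deriv f) x * (X 0 0 - X 1 1 - 2 * X 1 0 * f x)
        + (logDeriv (deriv f) x ^ 2 / 2 - schwarzReal f x) * pullQuadField X f x) x := by
  obtain ⟨hfx, hdx⟩ := hf.self_of_nhds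
  have deriv_eq : deriv (pullQuadField X f) =ᶠ[𝓝 x] fun y =>
      X 0 0 - X 1 1 - 2 * X 1 0 * f y - logDeriv (deriv f) y * pullQuadField X f y := by
    filter_upwards [hf] with y ⟨hfy, hdy⟩ using (hasDerivAt_pullQuadField hfy hdy).deriv
  refine (((((hasDerivAt_of_contDiffAt hfx).const_mul (2 * X 1 0)).const_sub
    (X 0 0 - X 1 1)).sub ((hasDerivAt_logDeriv_deriv hfx hdx).mul
      (hasDerivAt_pullQuadField hfx hdx))).congr_of_eventuallyEq deriv_eq).congr_deriv ?_
  ring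

theorem schwarzLie_pullQuadField (hf : ∀ᶠ y in 𝓝 x, ContDiffAt ℝ ∞ f y ∧ deriv f y ≠ 0) :
    schwarzLie (schwarzReal f) (pullQuadField X f) x = 0 := by
  obtain ⟨hfx, hdx⟩ := hf.self_of_nhds
  have D₀ := hasDerivAt_of_contDiffAt hfx
  have D₁ := hasDerivAt_of_contDiffAt (contDiffAt_deriv_infty hfx)
  have Dq := hasDerivAt_of_contDiffAt (contDiffAt_schwarzReal hfx hdx)
  have Dρ := hasDerivAt_logDeriv_deriv hfx hdx
  have Dψ := hasDerivAt_pullQuadField (X := X) hfx hdx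
  have deriv_deriv_eq : deriv (deriv (pullQuadField X f)) =ᶠ[𝓝 x] fun y =>
      -(2 * X 1 0 * deriv f y) - logDeriv (deriv f) y * (X 0 0 - X 1 1 - 2 * X 1 0 * f y)
        + (logDeriv (deriv f) y ^ 2 / 2 - schwarzReal f y) * pullQuadField X f y := by
    filter_upwards [hf.eventually_nhds] with y hy using (hasDerivAt_deriv_pullQuadField hy).deriv
  have third := ((((D₁.const_mul (2 * X 1 0)).neg).sub
    (Dρ.mul ((D₀.const_mul (2 * X 1 0)).const_sub (X 0 0 - X 1 1)))).add
      ((((Dρ.pow 2).div_const 2).sub Dq).mul Dψ)).congr_of_eventuallyEq deriv_deriv_eq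
  have hD₁ : deriv (deriv f) x = logDeriv (deriv f) x * deriv f x := by
    rw [logDeriv_apply, div_mul_cancel₀ _ hdx]
  rw [schwarzLie, quadLie, third.deriv, Dψ.deriv, hD₁]
  simp only [Pi.pow_apply, Pi.sub_apply]
  ring

open Polynomial in
theorem eq_smul_one_of_quadField_eq_zero {s : Set ℝ} (hs : s.Infinite)
    (h : ∀ t ∈ s, quadField X t = 0) : X = X 1 1 • (1 : Matrix (Fin 2) (Fin 2) ℝ) := by
  have quadratic : (C (-X 1 0) * Polynomial.X ^ 2 + C (X 0 0 - X 1 1) * Polynomial.X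
      + C (X 0 1) : ℝ[X]) = 0 := by
    refine Polynomial.eq_zero_of_infinite_isRoot _ (hs.mono fun t ht => ?_)
    rw [Set.mem_ofPred_eq, Polynomial.IsRoot.def, ← h t ht, quadField]
    simp only [eval_add, eval_mul, eval_pow, eval_C, eval_X]
    ring
  have coeff (n : ℕ) := congrArg (fun p => Polynomial.coeff p n) quadratic
  have h₀ : X 0 1 = 0 := by simpa using coeff 0
  have h₁ : X 0 0 = X 1 1 := by simpa [Polynomial.coeff_X, sub_eq_zero] using coeff 1
  have h₂ : X 1 0 = 0 := by simpa [Polynomial.coeff_X, Polynomial.coeff_C] using coeff 2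
  ext i j
  fin_cases i <;> fin_cases j <;> simp [h₀, h₁, h₂]

theorem eq_smul_one_of_pullQuadField_eq_zero (hf : ContDiffAt ℝ ∞ f x) (hd : deriv f x ≠ 0)
    (h : pullQuadField X f =ᶠ[𝓝 x] 0) : X = X 1 1 • (1 : Matrix (Fin 2) (Fin 2) ℝ) := by
  have strict : HasStrictDerivAt f (deriv f x) x := hf.hasStrictDerivAt (by simp)
  have deriv_ne : ∀ᶠ y in 𝓝 x, deriv f y ≠ 0 :=
    (contDiffAt_deriv_infty hf).continuousAt.eventually_ne hd
  have zeros : ∀ᶠ t in 𝓝 (f x), quadField X t = 0 := by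
    rw [← strict.map_nhds_eq hd, eventually_map]
    filter_upwards [h, deriv_ne] with y hy hdy
    exact (div_eq_zero_iff.1 hy).resolve_right hdy
  exact eq_smul_one_of_quadField_eq_zero (infinite_of_mem_nhds (f x) zeros) fun _ ht => ht

end RealPullback

theorem schwarzLie_congr {q q' ψ ψ' : ℝ → ℝ} {x : ℝ} (hq : q =ᶠ[𝓝 x] q') (hψ : ψ =ᶠ[𝓝 x] ψ') :
    schwarzLie q ψ x = schwarzLie q' ψ' x := by
  simp only [schwarzLie, quadLie, hq.eq_of_nhds, hψ.eq_of_nhds, hq.deriv_eq, hψ.deriv_eq,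
    hψ.deriv.deriv.deriv_eq]

namespace DevMap

variable {φ : DevMap} {X : Matrix (Fin 2) (Fin 2) ℝ} {g g' : GL (Fin 2) ℝ} {x : ℝ}

/-- The pull-back by a developing map of the vector field that `X` generates on the projective line,
computed in the affine chart `g`, in which `X` becomes its conjugate by `g`. -/
def pullFieldIn (φ : DevMap) (X : Matrix (Fin 2) (Fin 2) ℝ) (g : GL (Fin 2) ℝ) : ℝ → ℝ :=
  pullQuadField (g.1 * X * g⁻¹.1) fun y => coord (g • φ.toFun y)

/-- The pull-back by a developing map of the vector field that `X` generates on the projective line.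
At each point, any chart in which the point is finite may be used. -/
def pullField (φ : DevMap) (X : Matrix (Fin 2) (Fin 2) ℝ) (x : ℝ) : ℝ :=
  φ.pullFieldIn X (φ.immersion.exists_smul_ne_infty x).choose x

theorem pullFieldIn_eq_of_ne_infty (hg : g • φ.toFun x ≠ OnePoint.infty)
    (hg' : g' • φ.toFun x ≠ OnePoint.infty) :
    φ.pullFieldIn X g x = φ.pullFieldIn X g' x := by
  set B := g' * g⁻¹ with hB
  have change (z : RP1) : B • g • z = g' • z := by rw [hB, mul_smul, inv_smul_smul]
  have hconj : g'.1 * X * g'⁻¹.1 * B.1 = B.1 * (g.1 * X * g⁻¹.1) := by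
    simp only [hB, Units.val_mul, Matrix.mul_assoc, Units.inv_mul_cancel_left]
  have hcoord : (fun y => coord (g' • φ.toFun y)) =ᶠ[𝓝 x]
      fun y => coord (B • ((coord (g • φ.toFun y) : ℝ) : RP1)) := by
    filter_upwards [φ.immersion.eventually_smul_ne_infty hg] with y hy
    rw [coe_coord hy, change]
  rw [pullFieldIn, pullFieldIn, pullQuadField_congr hcoord, pullQuadField_coord_smul hconj
    ((φ.immersion.contDiffAt_coord hg).differentiableAt (by simp))]
  rwa [coe_coord hg, change]

theorem pullField_eq (hg : g • φ.toFun x ≠ OnePoint.infty) :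
    φ.pullField X x = φ.pullFieldIn X g x :=
  pullFieldIn_eq_of_ne_infty (φ.immersion.exists_smul_ne_infty x).choose_spec hg

theorem pullField_eventuallyEq (hg : g • φ.toFun x ≠ OnePoint.infty) :
    φ.pullField X =ᶠ[𝓝 x] φ.pullFieldIn X g :=
  (φ.immersion.eventually_smul_ne_infty hg).mono fun _ => pullField_eq

theorem contDiff_pullField (φ : DevMap) (X : Matrix (Fin 2) (Fin 2) ℝ) :
    ContDiff ℝ ∞ (φ.pullField X) := by
  refine contDiff_iff_contDiffAt.2 fun x => ?_
  obtain ⟨g, hg⟩ := φ.immersion.exists_smul_ne_infty x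
  exact (contDiffAt_pullQuadField (φ.immersion.contDiffAt_coord hg)
    (φ.immersion.deriv_coord_ne_zero hg)).congr_of_eventuallyEq (pullField_eventuallyEq hg)

theorem periodic_pullField {T : GL (Fin 2) ℝ} (hT : ∀ x, φ.toFun (x + 2 * Real.pi) = T • φ.toFun x)
    (hX : T.1 * X = X * T.1) : Function.Periodic (φ.pullField X) (2 * Real.pi) := by
  intro x
  obtain ⟨g, hg⟩ := φ.immersion.exists_smul_ne_infty (x + 2 * Real.pi)
  have hgT : (g * T) • φ.toFun x ≠ OnePoint.infty := by rwa [mul_smul, ← hT]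
  have hconj : (g * T).1 * X * (g * T)⁻¹.1 = g.1 * X * g⁻¹.1 := by
    rw [mul_inv_rev, Units.val_mul, Units.val_mul, Matrix.mul_assoc g.1, hX]
    simp only [Matrix.mul_assoc, Units.mul_inv_cancel_left]
  rw [pullField_eq hg, pullField_eq hgT, pullFieldIn, pullFieldIn, hconj]
  simp only [mul_smul, ← hT, pullQuadField]
  rw [deriv_comp_add_const (fun y => coord (g • φ.toFun y))]

theorem schwarzLie_pullField (φ : DevMap) (X : Matrix (Fin 2) (Fin 2) ℝ) (x : ℝ) :
    schwarzLie (schwarz φ.toFun) (φ.pullField X) x = 0 := by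
  obtain ⟨g, hg⟩ := φ.immersion.exists_smul_ne_infty x
  have hfin := φ.immersion.eventually_smul_ne_infty hg
  rw [schwarzLie_congr (hfin.mono fun _ => φ.immersion.schwarz_eq_schwarzReal)
    (pullField_eventuallyEq hg)]
  exact schwarzLie_pullQuadField <| hfin.mono fun _ hy =>
    ⟨φ.immersion.contDiffAt_coord hy, φ.immersion.deriv_coord_ne_zero hy⟩

theorem exists_pullField_ne_zero (φ : DevMap)
    (hX : ∀ c : ℝ, X ≠ c • (1 : Matrix (Fin 2) (Fin 2) ℝ)) : ∃ x, φ.pullField X x ≠ 0 := by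
  by_contra! hzero
  obtain ⟨g, hg⟩ := φ.immersion.exists_smul_ne_infty 0
  have hconj := eq_smul_one_of_pullQuadField_eq_zero (φ.immersion.contDiffAt_coord hg)
    (φ.immersion.deriv_coord_ne_zero hg) (X := g.1 * X * g⁻¹.1)
    ((pullField_eventuallyEq hg).symm.trans (.of_forall hzero))
  refine hX _ (?_ : X = (g.1 * X * g⁻¹.1) 1 1 • 1)
  calc X = g⁻¹.1 * (g.1 * X * g⁻¹.1) * g.1 := by
        simp only [Matrix.mul_assoc, Units.inv_mul_cancel_left, Units.inv_mul, mul_one]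
    _ = _ := by
        rw [hconj]
        simp

end DevMap

theorem exists_commuting_nonscalar (T : Matrix (Fin 2) (Fin 2) ℝ) :
    ∃ X : Matrix (Fin 2) (Fin 2) ℝ, T * X = X * T ∧
      ∀ c : ℝ, X ≠ c • (1 : Matrix (Fin 2) (Fin 2) ℝ) := by
  by_cases hT : ∃ c : ℝ, T = c • (1 : Matrix (Fin 2) (Fin 2) ℝ)
  · obtain ⟨c, rfl⟩ := hT
    refine ⟨!![0, 1; 0, 0], by simp, fun d hd => ?_⟩
    simpa using congrFun (congrFun hd 0) 1
  · exact ⟨T, rfl, fun c hc => hT ⟨c, hc⟩⟩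

section Monodromy

variable {T : GL (Fin 2) ℝ}

theorem exists_automorphism (α : PT T) : ∃ η : Vect, α.1.lie η = 0 ∧ ∃ x, η.1 x ≠ 0 := by
  obtain ⟨φ, hφ, hT⟩ := α.2
  obtain ⟨X, hX, hX'⟩ := exists_commuting_nonscalar T.1
  refine ⟨⟨φ.pullField X, φ.contDiff_pullField X, DevMap.periodic_pullField hT hX⟩, ?_,
    φ.exists_pullField_ne_zero hX'⟩
  rw [← hφ]
  exact funext (φ.schwarzLie_pullField X)

theorem exists_point_representing (α : PT T) :
    ∃ x₀ : ℝ, ∀ δ : α.1.Tangent, ∃ ξ : Vect, ξ.1 x₀ = 0 ∧ α.1.vel ξ = δ := by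
  obtain ⟨η, hη, x₀, hx₀⟩ := exists_automorphism α
  refine ⟨x₀, fun δ => ?_⟩
  obtain ⟨ξ, rfl⟩ := α.1.exists_vel_eq δ
  refine ⟨ξ - (ξ.1 x₀ / η.1 x₀) • η, ?_, Subtype.ext ?_⟩
  · simp [div_mul_cancel₀ _ hx₀]
  · change α.1.lie (ξ - (ξ.1 x₀ / η.1 x₀) • η) = α.1.lie ξ
    rw [map_sub, map_smul, hη, smul_zero, sub_zero]

theorem isGivenByIntegral_unique {σ σ' : ∀ α : PT T, α.1.Tangent → α.1.Tangent → ℝ}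
    (h : IsGivenByIntegral σ) (h' : IsGivenByIntegral σ') (α : PT T) (δ₁ δ₂ : α.1.Tangent) :
    σ' α δ₁ δ₂ = σ α δ₁ δ₂ := by
  obtain ⟨φ, hφ, -⟩ := α.2
  obtain ⟨x₀, hx₀⟩ := exists_point_representing α
  obtain ⟨ξ₁, h₁, rfl⟩ := hx₀ δ₁
  obtain ⟨ξ₂, h₂, rfl⟩ := hx₀ δ₂
  exact (h' α φ hφ 1 x₀ ξ₁ ξ₂ h₁ h₂).unique (h α φ hφ 1 x₀ ξ₁ ξ₂ h₁ h₂)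

end Monodromy

/-! ### Families of functions with parameters -/

section ParamDeriv

variable {E : Type*} [NormedAddCommGroup E] [NormedSpace ℝ E]

/-- The derivative of a family `X` of functions, along the vector `v` of the parameter space. -/
def paramDeriv (v : E) (X : E → ℝ → ℝ) (s : E) (x : ℝ) : ℝ := fderiv ℝ (fun r => X r x) s v

theorem contDiff_fderiv_apply_const {f : E → ℝ} (hf : ContDiff ℝ ∞ f) (v : E) :
    ContDiff ℝ ∞ fun p => fderiv ℝ f p v :=
  (hf.fderiv_right (m := ∞) (by simp)).clm_apply contDiff_const

theorem fderiv_fderiv_apply_comm {f : E → ℝ} (hf : ContDiff ℝ ∞ f) (p v w : E) :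
    fderiv ℝ (fun p => fderiv ℝ f p w) p v = fderiv ℝ (fun p => fderiv ℝ f p v) p w := by
  have hd : DifferentiableAt ℝ (fderiv ℝ f) p :=
    (hf.fderiv_right (m := ∞) (by simp)).differentiable (by simp) p
  have second (v w : E) :
      fderiv ℝ (fun p => fderiv ℝ f p w) p v = fderiv ℝ (fderiv ℝ f) p v w := by
    rw [fderiv_clm_apply hd (differentiableAt_const w)]
    simp
  rw [second, second]
  exact (contDiff_infty.1 hf 2).contDiffAt.isSymmSndFDerivAt (by simp) v w

variable {X Y : E → ℝ → ℝ}

theorem differentiableAt_param (hX : ContDiff ℝ ∞ (Function.uncurry X)) (s : E) (x : ℝ) :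
    DifferentiableAt ℝ (fun r => X r x) s :=
  (hX.comp (contDiff_prodMk_left x)).differentiable (by simp) s

theorem contDiff_of_uncurry (hX : ContDiff ℝ ∞ (Function.uncurry X)) (s : E) : ContDiff ℝ ∞ (X s) :=
  hX.comp (contDiff_prodMk_right s)

theorem paramDeriv_eq_fderiv (hX : ContDiff ℝ ∞ (Function.uncurry X)) (v s : E) (x : ℝ) :
    paramDeriv v X s x = fderiv ℝ (Function.uncurry X) (s, x) (v, 0) := by
  have hX' := (hX.differentiable (by simp) (s, x)).hasFDerivAt
  have hslice : HasFDerivAt (fun r => X r x) _ s :=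
    HasFDerivAt.comp (f := fun r => (r, x)) s hX' (hasFDerivAt_prodMk_left s x)
  exact congrArg (· v) hslice.fderiv

theorem deriv_eq_fderiv_uncurry (hX : ContDiff ℝ ∞ (Function.uncurry X)) (s : E) (x : ℝ) :
    deriv (X s) x = fderiv ℝ (Function.uncurry X) (s, x) (0, 1) :=
  ((hX.differentiable (by simp) (s, x)).hasFDerivAt.comp_hasDerivAt x
    ((hasDerivAt_const x s).prodMk (hasDerivAt_id x))).deriv

theorem uncurry_paramDeriv (hX : ContDiff ℝ ∞ (Function.uncurry X)) (v : E) :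
    Function.uncurry (paramDeriv v X) = fun p => fderiv ℝ (Function.uncurry X) p (v, 0) :=
  funext fun p => paramDeriv_eq_fderiv hX v p.1 p.2

theorem uncurry_deriv (hX : ContDiff ℝ ∞ (Function.uncurry X)) :
    (Function.uncurry fun s => deriv (X s)) = fun p => fderiv ℝ (Function.uncurry X) p (0, 1) :=
  funext fun p => deriv_eq_fderiv_uncurry hX p.1 p.2

theorem contDiff_uncurry_paramDeriv (hX : ContDiff ℝ ∞ (Function.uncurry X)) (v : E) :
    ContDiff ℝ ∞ (Function.uncurry (paramDeriv v X)) := by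
  rw [uncurry_paramDeriv hX]
  exact contDiff_fderiv_apply_const hX (v, 0)

theorem contDiff_uncurry_deriv (hX : ContDiff ℝ ∞ (Function.uncurry X)) :
    ContDiff ℝ ∞ (Function.uncurry fun s => deriv (X s)) := by
  rw [uncurry_deriv hX]
  exact contDiff_fderiv_apply_const hX (0, 1)

theorem paramDeriv_comm (hX : ContDiff ℝ ∞ (Function.uncurry X)) (v w s : E) :
    paramDeriv v (paramDeriv w X) s = paramDeriv w (paramDeriv v X) s :=
  funext fun x => fderiv_fderiv_apply_comm (hX.comp (contDiff_prodMk_left x)) s v w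

theorem deriv_paramDeriv (hX : ContDiff ℝ ∞ (Function.uncurry X)) (v s : E) :
    deriv (paramDeriv v X s) = paramDeriv v (fun s => deriv (X s)) s := by
  funext x
  rw [deriv_eq_fderiv_uncurry (contDiff_uncurry_paramDeriv hX v),
    paramDeriv_eq_fderiv (contDiff_uncurry_deriv hX), uncurry_deriv hX, uncurry_paramDeriv hX]
  exact fderiv_fderiv_apply_comm hX _ _ _

theorem paramDeriv_add (hX : ContDiff ℝ ∞ (Function.uncurry X))
    (hY : ContDiff ℝ ∞ (Function.uncurry Y)) (v s : E) :
    paramDeriv v (X + Y) s = paramDeriv v X s + paramDeriv v Y s := by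
  funext x
  exact congrArg (· v) (fderiv_add (differentiableAt_param hX s x) (differentiableAt_param hY s x))

theorem paramDeriv_mul (hX : ContDiff ℝ ∞ (Function.uncurry X))
    (hY : ContDiff ℝ ∞ (Function.uncurry Y)) (v s : E) :
    paramDeriv v (X * Y) s = paramDeriv v X s * Y s + X s * paramDeriv v Y s := by
  funext x
  refine (congrArg (· v)
    (fderiv_mul (differentiableAt_param hX s x) (differentiableAt_param hY s x))).trans ?_
  simp [paramDeriv, mul_comm, add_comm]

theorem paramDeriv_quadLie {Q : E → ℝ → ℝ} (hX : ContDiff ℝ ∞ (Function.uncurry X))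
    (hQ : ContDiff ℝ ∞ (Function.uncurry Q)) (v s : E) :
    paramDeriv v (fun s => quadLie (X s) (Q s)) s =
      quadLie (paramDeriv v X s) (Q s) + quadLie (X s) (paramDeriv v Q s) := by
  have hX' := contDiff_uncurry_deriv hX
  have hQ' := contDiff_uncurry_deriv hQ
  have expand : (fun s => quadLie (X s) (Q s)) = X * (fun s => deriv (Q s)) +
      ((fun s => deriv (X s)) * Q + (fun s => deriv (X s)) * Q) := by
    funext s x
    simp only [quadLie, Pi.add_apply, Pi.mul_apply]
    ring
  rw [expand, paramDeriv_add (hX.mul hQ') ((hX'.mul hQ).add (hX'.mul hQ)),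
    paramDeriv_add (hX'.mul hQ) (hX'.mul hQ), paramDeriv_mul hX hQ', paramDeriv_mul hX' hQ,
    ← deriv_paramDeriv hX, ← deriv_paramDeriv hQ]
  funext x
  simp only [quadLie, Pi.add_apply, Pi.mul_apply]
  ring

theorem contDiff_uncurry_schwarzLie {Q : E → ℝ → ℝ} (hQ : ContDiff ℝ ∞ (Function.uncurry Q))
    (hX : ContDiff ℝ ∞ (Function.uncurry X)) :
    ContDiff ℝ ∞ (Function.uncurry fun s => schwarzLie (Q s) (X s)) := by
  have hX' := contDiff_uncurry_deriv hX
  exact ((hX.mul (contDiff_uncurry_deriv hQ)).add ((contDiff_const.mul hX').mul hQ)).add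
    (contDiff_uncurry_deriv (contDiff_uncurry_deriv hX'))

theorem paramDeriv_schwarzLie {Q : E → ℝ → ℝ} (hQ : ContDiff ℝ ∞ (Function.uncurry Q))
    (hX : ContDiff ℝ ∞ (Function.uncurry X)) (v s : E) :
    paramDeriv v (fun s => schwarzLie (Q s) (X s)) s =
      schwarzLie (Q s) (paramDeriv v X s) + quadLie (X s) (paramDeriv v Q s) := by
  have hX' := contDiff_uncurry_deriv hX
  have hX'' := contDiff_uncurry_deriv hX'
  have hquad : ContDiff ℝ ∞ (Function.uncurry fun s => quadLie (X s) (Q s)) :=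
    (hX.mul (contDiff_uncurry_deriv hQ)).add ((contDiff_const.mul hX').mul hQ)
  have expand : (fun s => schwarzLie (Q s) (X s)) =
      (fun s => quadLie (X s) (Q s)) + fun s => deriv (deriv (deriv (X s))) := rfl
  rw [expand, paramDeriv_add hquad (contDiff_uncurry_deriv hX''), paramDeriv_quadLie hX hQ,
    ← deriv_paramDeriv hX'', ← deriv_paramDeriv hX', ← deriv_paramDeriv hX]
  funext x
  simp only [schwarzLie, Pi.add_apply]
  ring

theorem paramDeriv_mem_Vect (hX : ContDiff ℝ ∞ (Function.uncurry X)) (hmem : ∀ s, X s ∈ Vect)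
    (v s : E) : paramDeriv v X s ∈ Vect := by
  refine ⟨contDiff_of_uncurry (contDiff_uncurry_paramDeriv hX v) s, fun x => ?_⟩
  simp only [paramDeriv, (hmem _).2 x]

end ParamDeriv

/-! ### Closedness -/

section Closed

variable {E : Type} [NormedAddCommGroup E] [NormedSpace ℝ E]

theorem contDiff_pairing {M X : E → ℝ → ℝ} (hM : ContDiff ℝ ∞ (Function.uncurry M))
    (hX : ContDiff ℝ ∞ (Function.uncurry X)) : ContDiff ℝ ∞ fun s => pairing (M s) (X s) :=
  contDiff_parametric_integral (hM.mul hX) _ _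

theorem fderiv_pairing {M X : E → ℝ → ℝ} (hM : ContDiff ℝ ∞ (Function.uncurry M))
    (hX : ContDiff ℝ ∞ (Function.uncurry X)) (s v : E) :
    fderiv ℝ (fun s => pairing (M s) (X s)) s v =
      pairing (paramDeriv v M s) (X s) + pairing (M s) (paramDeriv v X s) := by
  have hMX : ContDiff ℝ ∞ (Function.uncurry (M * X)) := hM.mul hX
  have continuous {Y : E → ℝ → ℝ} (hY : ContDiff ℝ ∞ (Function.uncurry Y)) : Continuous (Y s) :=
    (contDiff_of_uncurry hY s).continuous
  have hM' := continuous (contDiff_uncurry_paramDeriv hM v)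
  have hX' := continuous (contDiff_uncurry_paramDeriv hX v)
  have hderiv : Continuous fun x => fderiv ℝ (Function.uncurry (M * X)) (s, x) :=
    (hMX.continuous_fderiv (by simp)).comp (Continuous.prodMk_right s)
  calc fderiv ℝ (fun s => pairing (M s) (X s)) s v
      = ∫ x in (0 : ℝ)..(2 * Real.pi), fderiv ℝ (Function.uncurry (M * X)) (s, x) (v, 0) := by
        have hint := hasFDerivAt_parametric_integral (hMX.of_le (by simp)) 0 (2 * Real.pi) s
        refine (congrArg (· v) hint.fderiv).trans ?_
        rw [ContinuousLinearMap.intervalIntegral_apply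
          ((hderiv.clm_comp continuous_const).intervalIntegrable _ _)]
        rfl
    _ = ∫ x in (0 : ℝ)..(2 * Real.pi),
          (paramDeriv v M s x * X s x + M s x * paramDeriv v X s x) := by
        simp only [← paramDeriv_eq_fderiv hMX, paramDeriv_mul hM hX, Pi.add_apply, Pi.mul_apply]
    _ = _ := intervalIntegral.integral_add
        ((hM'.mul (continuous hX)).intervalIntegrable _ _)
        (((continuous hM).mul hX').intervalIntegrable _ _)

variable {ι : Type*} {v : ι → E} {Q : E → ℝ → ℝ} {ξ : ι → E → ℝ → ℝ}

section Variation

variable (hQ : ContDiff ℝ ∞ (Function.uncurry Q)) (hQ' : ∀ s, Q s ∈ Vect)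
  (hξ : ∀ i, ContDiff ℝ ∞ (Function.uncurry (ξ i))) (hξ' : ∀ i s, ξ i s ∈ Vect)
  (velocity : ∀ i s, paramDeriv (v i) Q s = schwarzLie (Q s) (ξ i s))
include hQ hξ velocity

theorem paramDeriv_velocity (i k : ι) (s : E) :
    paramDeriv (v k) (fun s => schwarzLie (Q s) (ξ i s)) s =
      schwarzLie (Q s) (paramDeriv (v i) (ξ k) s) + quadLie (ξ k s) (schwarzLie (Q s) (ξ i s)) := by
  rw [← velocity i s, ← paramDeriv_schwarzLie hQ (hξ k), ← funext (velocity i),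
    ← funext (velocity k), paramDeriv_comm hQ]

include hQ' hξ'

theorem fderiv_pairing_schwarzLie (i j k : ι) (s : E) :
    fderiv ℝ (fun s => pairing (schwarzLie (Q s) (ξ i s)) (ξ j s)) s (v k) =
      pairing (schwarzLie (Q s) (paramDeriv (v i) (ξ k) s)) (ξ j s) +
      pairing (schwarzLie (Q s) (ξ i s)) (fieldBracket (ξ j s) (ξ k s)) -
      pairing (schwarzLie (Q s) (paramDeriv (v k) (ξ j) s)) (ξ i s) := by
  have hm := schwarzLie_mem_Vect (hQ' s) (hξ' i s)
  have hik := paramDeriv_mem_Vect (hξ k) (hξ' k) (v i) s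
  have hkj := paramDeriv_mem_Vect (hξ j) (hξ' j) (v k) s
  rw [fderiv_pairing (contDiff_uncurry_schwarzLie hQ (hξ i)) (hξ j),
    paramDeriv_velocity hQ hξ velocity,
    pairing_add_left (schwarzLie_mem_Vect (hQ' s) hik) (quadLie_mem_Vect (hξ' k s) hm) (hξ' j s),
    pairing_quadLie hm (hξ' k s) (hξ' j s), pairing_schwarzLie_swap (hQ' s) (hξ' i s) hkj,
    sub_eq_add_neg]

/-- The derivatives of the vector fields cancel in pairs, which leaves the cocycle identity. -/
theorem fderiv_pairing_schwarzLie_cyclic (i j k : ι) (s : E) :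
    fderiv ℝ (fun s => pairing (schwarzLie (Q s) (ξ j s)) (ξ k s)) s (v i) +
      fderiv ℝ (fun s => pairing (schwarzLie (Q s) (ξ k s)) (ξ i s)) s (v j) +
      fderiv ℝ (fun s => pairing (schwarzLie (Q s) (ξ i s)) (ξ j s)) s (v k) = 0 := by
  simp only [fderiv_pairing_schwarzLie hQ hQ' hξ hξ' velocity]
  linear_combination pairing_schwarzLie_cocycle (hQ' s) (hξ' i s) (hξ' j s) (hξ' k s)

end Variation

theorem isSmoothClosed_form (T : GL (Fin 2) ℝ) : IsSmoothClosed (T := T) fun α => α.1.form := by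
  intro F ξ h Ω hΩ
  have hpairing (i j : Fin 3) : Ω i j =
      fun s => pairing (schwarzLie (F s).1.schwarzian (ξ i s)) (ξ j s) :=
    funext fun s => (hΩ i j s).trans ((F s).1.form_vel (ξ i s) (ξ j s))
  have velocity (i : Fin 3) (s : Fin 3 → ℝ) :
      paramDeriv (Pi.single i 1) (fun s => (F s).1.schwarzian) s =
        schwarzLie (F s).1.schwarzian (ξ i s) := funext (h.velocity i s)
  refine ⟨fun i j => ?_, fun s => ?_⟩
  · rw [hpairing]
    exact contDiff_pairing (contDiff_uncurry_schwarzLie h.smooth (h.smooth_field i))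
      (h.smooth_field j)
  · rw [hpairing, hpairing, hpairing]
    exact fderiv_pairing_schwarzLie_cyclic (v := fun i => Pi.single i 1)
      (Q := fun s => (F s).1.schwarzian) (ξ := fun i s => (ξ i s).1) h.smooth
      (fun s => (F s).1.schwarzian_mem_Vect) h.smooth_field (fun i s => (ξ i s).2) velocity 0 1 2 s

end Closed

end CircleProj

end

theorem mainTheorem7 (T : GL (Fin 2) ℝ) :
    -- every tangent vector is represented by a vector field that vanishes at a suitable point
    (∀ α : CircleProj.PT T, ∃ x₀ : ℝ, ∀ δ : α.1.Tangent, ∃ ξ : CircleProj.Vect,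
      ξ.1 x₀ = 0 ∧ α.1.vel ξ = δ) ∧
    ∃ σ : ∀ α : CircleProj.PT T, LinearMap.BilinForm ℝ α.1.Tangent,
      -- the integral does not depend on any choice, and it defines the form
      CircleProj.IsGivenByIntegral (fun α δ₁ δ₂ => σ α δ₁ δ₂) ∧
      (∀ σ' : ∀ α : CircleProj.PT T, α.1.Tangent → α.1.Tangent → ℝ,
        CircleProj.IsGivenByIntegral σ' → ∀ α δ₁ δ₂, σ' α δ₁ δ₂ = σ α δ₁ δ₂) ∧
      -- it is an ordinary integral when the parameter is finite along the developing map
      (∀ (α : CircleProj.PT T) (φ : CircleProj.DevMap), φ.struct = α.1 →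
        ∀ (g : GL (Fin 2) ℝ) (x₀ : ℝ) (ξ₁ ξ₂ : CircleProj.Vect), ξ₁.1 x₀ = 0 → ξ₂.1 x₀ = 0 →
        (∀ x ∈ Set.Ioo x₀ (x₀ + 2 * Real.pi), g • φ.toFun x ≠ OnePoint.infty) →
        IntervalIntegrable (CircleProj.density (CircleProj.pullForm g φ) ξ₁.1 ξ₂.1) volume
          x₀ (x₀ + 2 * Real.pi) ∧
        ∫ x in x₀..(x₀ + 2 * Real.pi), CircleProj.density (CircleProj.pullForm g φ) ξ₁.1 ξ₂.1 x
          = σ α (α.1.vel ξ₁) (α.1.vel ξ₂)) ∧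
      -- it is a closed nondegenerate 2-form
      (∀ α, (σ α).IsAlt) ∧
      CircleProj.IsSmoothClosed σ ∧
      (∀ α, (σ α).Nondegenerate) ∧
      -- the formula with the Schwarzian derivative
      (∀ (α : CircleProj.PT T) (φ : CircleProj.DevMap), φ.struct = α.1 →
        ∀ ξ₁ ξ₂ : CircleProj.Vect,
        σ α (α.1.vel ξ₁) (α.1.vel ξ₂) =
          -(∫ x in (0 : ℝ)..(2 * Real.pi), CircleProj.schwarz φ.toFun x *
              (ξ₁.1 x * deriv ξ₂.1 x - deriv ξ₁.1 x * ξ₂.1 x))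
          + ∫ x in (0 : ℝ)..(2 * Real.pi), deriv ξ₁.1 x * deriv (deriv ξ₂.1) x) := by
  exact ⟨CircleProj.exists_point_representing, fun α => α.1.form,
    CircleProj.isGivenByIntegral_form T,
    fun _ h => CircleProj.isGivenByIntegral_unique (CircleProj.isGivenByIntegral_form T) h,
    fun _ _ hφ g _ _ _ h₁ h₂ hfin =>
      CircleProj.ProjStr.intervalIntegrable_density_and_integral_eq_form hφ g h₁ h₂ hfin,
    fun α => α.1.form_isAlt, CircleProj.isSmoothClosed_form T,
    fun α => α.1.form_nondegenerate,
    fun _ _ hφ ξ₁ ξ₂ => CircleProj.ProjStr.form_vel_eq_schwarz hφ ξ₁ ξ₂⟩
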